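/- **Conventions.** Let $\mathcal C$ be an abelian category in which every object has finite length (is noetherian and artinian), equipped with a torsion pair $(\mathcal X,\mathcal Y)$: strictly full subcategories with $\mathrm{Hom}_{\mathcal C}(X,Y)=0$ for all $X\in\mathcal X$, $Y\in\mathcal Y$, such that every object $Z$ of $\mathcal C$ sits in an exact sequence $0\to X\to Z\to Y\to 0$ with $X\in\mathcal X$, $Y\in\mathcal Y$. An abelian category is *semi-simple* if all its short exact sequences split, and *hereditary* if its groups $\mathrm{Ext}^n$ vanish for all $n\ge 2$. For a ring $A$, possibly without unit, $A$-modules are left modules $N$ with $AN=N$; if $A$ has a unit, these are the usual unital modules. Write $A$-$\mathrm{mod}$ (resp. $A$-$\mathrm{Mod}^{ss}$) for the category of $A$-modules of finite length (resp. of semi-simple $A$-modules). **Data.** Let $(S_i)_{i\in I}$ and $(T_j)_{j\in J}$ be representatives of the isomorphism classes of simple objects of $\mathcal X$ and of $\mathcal Y$. Put $D_{S_i}=\mathrm{End}_{\mathcal X}(S_i)^{\mathrm{op}}$, $D_{T_j}=\mathrm{End}_{\mathcal Y}(T_j)^{\mathrm{op}}$, $R_{\mathcal X}=\bigoplus_{i\in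 I} D_{S_i}$, $R_{\mathcal Y}=\bigoplus_{j\in J}D_{T_j}$, and let $\mathbf M_{\mathcal X}$ be the functor $X\mapsto\bigoplus_{i\in I}\mathrm{Hom}_{\mathcal X}(S_i,X)$ from $\mathcal X$ to $R_{\mathcal X}$-modules. Assume: (a) $\mathcal X$ and $\mathcal Y$ are Serre subcategories of $\mathcal C$; (b) $\mathcal X$ and $\mathcal Y$ are semi-simple; (c) $\mathrm{Hom}_{\mathcal C}(Y,X)=0$ for all $X\in\mathcal X$, $Y\in\mathcal Y$; (d) there are a semi-simple abelian category $\widetilde{\mathcal X}$ containing $\mathcal X$ as a Serre subcategory, a covariant exact functor $\mathbf F:\mathcal Y\to\widetilde{\mathcal X}$, and a bifunctorial isomorphism $\mathrm{Ext}^1_{\mathcal C}(Y,X)\cong\mathrm{Hom}_{\widetilde{\mathcal X}}(\mathbf F(Y),X)$ for $X\in\mathcal X$, $Y\in\mathcal Y$; (e) $\mathbf M_{\mathcal X}$ extends to an equivalence of categories $\mathbf M_{\widetilde{\mathcal X}}:\widetilde{\mathcal X}\to R_{\mathcal X}\text{-}\mathrm{Mod}^{ss}$. Let $\widetilde{\mathcal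 F}$ be the category of triples $(X,Y,\eta)$ with $X\in\widetilde{\mathcal X}$, $Y\in\mathcal Y$ and $\eta\in\mathrm{Hom}_{\widetilde{\mathcal X}}(\mathbf F(Y),X)$; a morphism $(X,Y,\eta)\to(X',Y',\eta')$ is a pair $(u:X\to X',\,v:Y\to Y')$ with $u\circ\eta=\eta'\circ\mathbf F(v)$. Let $\mathcal F$ be the full subcategory of triples with $X\in\mathcal X$. Let $M=\bigoplus_{j\in J}\mathbf M_{\widetilde{\mathcal X}}(\mathbf F(T_j))$, an $R_{\mathcal X}$-$R_{\mathcal Y}$-bimodule in which $D_{T_j}$ acts from the right on the $j$-th summand through $\mathbf F$. Let $$R=\begin{pmatrix}R_{\mathcal Y}&0\\ M&R_{\mathcal X}\end{pmatrix}$$ be the triangular matrix ring, and let $R$-$\widetilde{\mathrm{mod}}$ be the category of locally finite $R$-modules, i.e. the $R$-modules which, as modules over the subring $R_{\mathcal X}\oplus R_{\mathcal Y}$, are the direct sum of a semi-simple $R_{\mathcal X}$-module and an $R_{\mathcal Y}$-module of finite length. **Theorem.** The categories $\mathcal F$ and $\widetilde{\mathcal F}$ are abelian and hereditary, and $\widetilde{\mathcal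 F}$ has enough projectives. Moreover, there are equivalences of categories $$\mathbf M:\mathcal F\xrightarrow{\ \cong\ }R\text{-}\mathrm{mod},\qquad \widetilde{\mathbf M}:\widetilde{\mathcal F}\xrightarrow{\ \cong\ }R\text{-}\widetilde{\mathrm{mod}},$$ which are compatible: the restriction of $\widetilde{\mathbf M}$ to $\mathcal F$ is isomorphic to $\mathbf M$, as functors to $R$-modules. -/

import Mathlib

open CategoryTheory CategoryTheory.Limits CategoryTheory.Abelian

universe w w' v v' u u'

noncomputable section

namespace TorsionExt

/-! ### Homological notions -/

/-- A torsion pair `(𝒳, 𝒴)` of strictly full subcategories of an abelian category. -/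
structure IsTorsionPair {C : Type u} [Category.{v} C] [Abelian C]
    (𝒳 𝒴 : ObjectProperty C) : Prop where
  isoClosed_left : 𝒳.IsClosedUnderIsomorphisms
  isoClosed_right : 𝒴.IsClosedUnderIsomorphisms
  hom_eq_zero : ∀ ⦃X Y : C⦄, 𝒳 X → 𝒴 Y → ∀ f : X ⟶ Y, f = 0
  exists_shortExact : ∀ Z : C, ∃ (X Y : C) (f : X ⟶ Z) (g : Z ⟶ Y) (h : f ≫ g = 0),
    𝒳 X ∧ 𝒴 Y ∧ (ShortComplex.mk f g h).ShortExact

/-- Semi-simplicity: every short exact sequence splits. -/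
def IsSemisimpleCategory (A : Type u) [Category.{v} A] [Preadditive A] : Prop :=
  ∀ S : ShortComplex A, S.ShortExact → Nonempty S.Splitting

/-- The category `A` is abelian and its homological dimension is at most one, that is,
`Ext ^ n` vanishes for all `n ≥ 2`. (The additive structure of an abelian category is
determined by the underlying category, so being abelian is a property of `A`.) -/
def IsHereditaryAbelian (A : Type u) [Category.{v} A] : Prop :=
  ∃ _ : Abelian A, letI := HasExt.standard A
    ∀ (X Y : A) (n : ℕ), 2 ≤ n → ∀ e : Ext.{max u v} X Y n, e = 0

/-- The inclusion of the category of triples `(Y, X, F(Y) ⟶ X)` with `X` in `𝒳` into the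
category of such triples with `X` in the larger category `𝒳t`. -/
def commaIncl {𝒳 : Type*} [Category* 𝒳] {𝒴 : Type*} [Category* 𝒴] {𝒳t : Type*} [Category* 𝒳t]
    (F : 𝒴 ⥤ 𝒳t) (inc : 𝒳 ⥤ 𝒳t) : Comma F inc ⥤ Comma F (𝟭 𝒳t) where
  obj Z := { left := Z.left, right := inc.obj Z.right, hom := Z.hom }
  map f := { left := f.left, right := inc.map f.right, w := f.w }

/-! ### Modules over a ring without unit

Left modules over a (possibly non-unital) ring `A`, i.e. abelian groups with a ring
homomorphism from `A` to their endomorphism ring, are the same as unital left modules over the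
ring `ℤ ⊕ A` obtained from `A` by adjoining a unit. -/

/-- The ring `ℤ ⊕ A` obtained from `A` by adjoining a unit. -/
def Plus (A : Type u) [NonUnitalRing A] : Type u := Unitization ℤ A

namespace Plus

instance (A : Type u) [NonUnitalRing A] : Ring (Plus A) := inferInstanceAs (Ring (Unitization ℤ A))

/-- The inclusion of `A` in `ℤ ⊕ A`, a ring homomorphism. -/
def of {A : Type u} [NonUnitalRing A] : A →ₙ+* Plus A where
  toFun a := (Unitization.inr a : Unitization ℤ A)
  map_zero' := Unitization.inr_zero ℤ
  map_add' := Unitization.inr_add ℤ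
  map_mul' := Unitization.inr_mul ℤ

end Plus

/-- The `A`-module structure on `N` given by a ring homomorphism from `A` to the endomorphisms
of `N`. -/
@[reducible]
def moduleOfAction {A N : Type*} [NonUnitalRing A] [AddCommGroup N]
    (φ : A →ₙ+* AddMonoid.End N) : Module (Plus A) N where
  smul (r : Unitization ℤ A) n := r.fst • n + φ r.snd n
  one_smul n := by
    change (1 : Unitization ℤ A).fst • n + φ (1 : Unitization ℤ A).snd n = n
    simp
  mul_smul (r s : Unitization ℤ A) n := by
    change (r * s).fst • n + φ (r * s).snd n =
      r.fst • (s.fst • n + φ s.snd n) + φ r.snd (s.fst • n + φ s.snd n)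
    rw [Unitization.fst_mul, Unitization.snd_mul, map_add, map_add, map_mul, map_zsmul,
      map_zsmul, map_add, map_zsmul, smul_add, mul_smul]
    change _ + (r.fst • φ s.snd n + s.fst • φ r.snd n + φ r.snd (φ s.snd n)) = _
    abel
  smul_zero (r : Unitization ℤ A) := by
    change r.fst • (0 : N) + φ r.snd 0 = 0
    simp
  zero_smul n := by
    change (0 : Unitization ℤ A).fst • n + φ (0 : Unitization ℤ A).snd n = 0
    simp
  smul_add (r : Unitization ℤ A) n n' := by
    change r.fst • (n + n') + φ r.snd (n + n') =
      (r.fst • n + φ r.snd n) + (r.fst • n' + φ r.snd n')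
    simp only [smul_add, map_add]
    abel
  add_smul (r s : Unitization ℤ A) n := by
    change (r + s).fst • n + φ (r + s).snd n =
      (r.fst • n + φ r.snd n) + (s.fst • n + φ s.snd n)
    rw [Unitization.fst_add, Unitization.snd_add, add_smul, map_add]
    change _ + (φ r.snd n + φ s.snd n) = _
    abel

/-- The module `N` over the ring `A` satisfies `A N = N`. If `A` has a unit, this means that
the unit acts on `N` as the identity. -/
def IsUnitalModule (A : Type*) [NonUnitalRing A] (N : Type*) [AddCommGroup N]
    [Module (Plus A) N] : Prop :=
  AddSubgroup.closure {n : N | ∃ (a : A) (m : N), n = Plus.of a • m} = ⊤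

/-- The `A`-modules of finite length (with `A N = N`). -/
def finiteLengthModules (A : Type u) [NonUnitalRing A] :
    ObjectProperty (ModuleCat.{w} (Plus A)) :=
  fun N => IsUnitalModule A N ∧ IsFiniteLength (Plus A) N

/-- The semi-simple `A`-modules (with `A N = N`). -/
def semisimpleModules (A : Type u) [NonUnitalRing A] :
    ObjectProperty (ModuleCat.{w} (Plus A)) :=
  fun N => IsUnitalModule A N ∧ IsSemisimpleModule (Plus A) N

/-! ### The ring `⨁ D i` -/

/-- The direct sum `⨁ D i` of a family of rings, with componentwise multiplication
(a ring without unit if there are infinitely many non-zero `D i`). -/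
def SumRing {I : Type*} (D : I → Type*) [∀ i, Ring (D i)] := Π₀ i, D i

namespace SumRing

variable {I : Type*} (D : I → Type*) [∀ i, Ring (D i)]

instance : AddCommGroup (SumRing D) := inferInstanceAs (AddCommGroup (Π₀ i, D i))

/-- The components of an element of the direct sum. -/
def coeff {D : I → Type*} [∀ i, Ring (D i)] (a : SumRing D) (i : I) : D i :=
  DFunLike.coe (F := Π₀ i, D i) a i

instance : Mul (SumRing D) where
  mul a b := DFinsupp.zipWith (fun _ x y => x * y) (fun _ => mul_zero 0) a b

variable {D}

@[ext]
lemma ext {a b : SumRing D} (h : ∀ i, a.coeff i = b.coeff i) : a = b :=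
  DFinsupp.ext h

@[simp]
lemma coeff_zero (i : I) : (0 : SumRing D).coeff i = 0 := rfl

@[simp]
lemma coeff_add (a b : SumRing D) (i : I) : (a + b).coeff i = a.coeff i + b.coeff i := rfl

@[simp]
lemma coeff_mul (a b : SumRing D) (i : I) : (a * b).coeff i = a.coeff i * b.coeff i :=
  DFinsupp.zipWith_apply _ _ _ _ _

variable (D)

instance : NonUnitalRing (SumRing D) where
  left_distrib a b c := by ext i; simp [mul_add]
  right_distrib a b c := by ext i; simp [add_mul]
  zero_mul a := by ext i; simp
  mul_zero a := by ext i; simp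
  mul_assoc a b c := by ext i; simp [mul_assoc]

end SumRing

/-! ### The ring attached to a family of objects, and its modules `⨁ Hom(S i, X)` -/

section HomSum

variable {𝒜 : Type u} [Category.{v} 𝒜] [Preadditive 𝒜] {I : Type w} (S : I → 𝒜)

/-- The ring `⨁ D i`, where `D i` is the opposite of the endomorphism ring of `S i`.
(In `End X`, the product `f * g` is the composition `f ∘ g`.) -/
abbrev EndRing : Type (max w v) := SumRing fun i => (End (S i))ᵐᵒᵖ

/-- The abelian group `⨁ Hom(S i, X)`. -/
def HomSum (X : 𝒜) : Type (max w v) := Π₀ i, (S i ⟶ X)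

namespace HomSum

variable {S} {X X' X'' : 𝒜}

instance : AddCommGroup (HomSum S X) := inferInstanceAs (AddCommGroup (Π₀ i, (S i ⟶ X)))

/-- The components of an element of `⨁ Hom(S i, X)`. -/
def coeff (m : HomSum S X) (i : I) : S i ⟶ X := DFunLike.coe (F := Π₀ i, (S i ⟶ X)) m i

@[ext]
lemma ext {m n : HomSum S X} (h : ∀ i, m.coeff i = n.coeff i) : m = n :=
  DFinsupp.ext h

@[simp]
lemma coeff_zero (i : I) : (0 : HomSum S X).coeff i = 0 := rfl

@[simp]
lemma coeff_add (m n : HomSum S X) (i : I) : (m + n).coeff i = m.coeff i + n.coeff i := rfl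

/-- The action of `⨁ D i` on `⨁ Hom(S i, X)`: the component `D i` acts on `Hom(S i, X)` by
composition on the source, and on the other summands by zero. -/
def act (a : EndRing S) (m : HomSum S X) : HomSum S X :=
  DFinsupp.zipWith (fun _ (d : (End (S _))ᵐᵒᵖ) (f : S _ ⟶ X) => d.unop ≫ f)
    (fun _ => by simp) a m

@[simp]
lemma coeff_act (a : EndRing S) (m : HomSum S X) (i : I) :
    (act a m).coeff i = (a.coeff i).unop ≫ m.coeff i :=
  DFinsupp.zipWith_apply _ _ _ _ _

variable (S X) in
/-- The action of `⨁ D i` on `⨁ Hom(S i, X)`, as a ring homomorphism. -/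
def actHom : EndRing S →ₙ+* AddMonoid.End (HomSum S X) where
  toFun a :=
    { toFun := act a
      map_zero' := by ext i; simp
      map_add' := fun m n => by ext i; simp }
  map_zero' := by
    apply AddMonoidHom.ext
    intro m
    apply HomSum.ext
    intro i
    change (act 0 m).coeff i = 0
    simp
  map_add' a b := by
    apply AddMonoidHom.ext
    intro m
    apply HomSum.ext
    intro i
    change (act (a + b) m).coeff i = (act a m + act b m).coeff i
    rw [coeff_add, coeff_act, coeff_act, coeff_act]
    exact Preadditive.add_comp _ _ _ _ _ _
  map_mul' a b := by
    apply AddMonoidHom.ext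
    intro m
    apply HomSum.ext
    intro i
    change (act (a * b) m).coeff i = (act a (act b m)).coeff i
    simp [End.mul_def]

instance : Module (Plus (EndRing S)) (HomSum S X) := moduleOfAction (actHom S X)

lemma smul_def (r : Plus (EndRing S)) (m : HomSum S X) :
    r • m = (show Unitization ℤ (EndRing S) from r).fst • m +
      act (show Unitization ℤ (EndRing S) from r).snd m := rfl

/-- Functoriality of `⨁ Hom(S i, X)` in `X`, on elements. -/
def mapFun (f : X ⟶ X') (m : HomSum S X) : HomSum S X' :=
  DFinsupp.mapRange (fun _ (g : S _ ⟶ X) => g ≫ f) (fun _ => zero_comp) m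

@[simp]
lemma coeff_mapFun (f : X ⟶ X') (m : HomSum S X) (i : I) :
    (mapFun f m).coeff i = m.coeff i ≫ f :=
  DFinsupp.mapRange_apply _ _ _ _

/-- Functoriality of `⨁ Hom(S i, X)` in `X`, as an additive map. -/
def mapAdd (f : X ⟶ X') : HomSum S X →+ HomSum S X' where
  toFun := mapFun f
  map_zero' := by ext i; simp
  map_add' m n := by ext i; simp

@[simp]
lemma coeff_mapAdd (f : X ⟶ X') (m : HomSum S X) (i : I) :
    (mapAdd f m).coeff i = m.coeff i ≫ f :=
  coeff_mapFun _ _ _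

/-- Functoriality of `⨁ Hom(S i, X)` in `X`. -/
def map (f : X ⟶ X') : HomSum S X →ₗ[Plus (EndRing S)] HomSum S X' where
  toFun := mapAdd f
  map_add' := map_add _
  map_smul' r m := by
    simp only [smul_def, map_add, map_zsmul, RingHom.id_apply]
    congr 1
    ext i
    simp

end HomSum

/-- The functor `X ↦ ⨁ Hom(S i, X)` to modules over `⨁ D i`. -/
def homFunctor : 𝒜 ⥤ ModuleCat.{max w v} (Plus (EndRing S)) where
  obj X := ModuleCat.of _ (HomSum S X)
  map f := ModuleCat.ofHom (HomSum.map f)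
  map_id X := by
    apply ModuleCat.hom_ext
    apply LinearMap.ext
    intro m
    apply HomSum.ext
    intro i
    change (HomSum.mapAdd (𝟙 X) m).coeff i = m.coeff i
    simp
  map_comp f g := by
    apply ModuleCat.hom_ext
    apply LinearMap.ext
    intro m
    apply HomSum.ext
    intro i
    change (HomSum.mapAdd (f ≫ g) m).coeff i =
      (HomSum.mapAdd g (HomSum.mapAdd f m)).coeff i
    simp

/-- `S` is a family of representatives of the isomorphism classes of simple objects. -/
structure IsSimpleRepresentatives : Prop where
  simple : ∀ i, Simple (S i)
  injective : ∀ i j, Nonempty (S i ≅ S j) → i = j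
  exhaustive : ∀ X : 𝒜, Simple X → ∃ i, Nonempty (X ≅ S i)

end HomSum

/-! ### The triangular matrix ring -/

section Triangular

variable {𝒴 : Type u} [Category.{v} 𝒴] [Preadditive 𝒴] {J : Type w} (T : J → 𝒴)
  (A : Type u') [NonUnitalRing A] (G : 𝒴 ⥤ ModuleCat.{v'} (Plus A))

/-- The bimodule `M = ⨁ G(T j)`. -/
abbrev BiMod : Type (max w v') := Π₀ j, (G.obj (T j) : Type v')

variable {T A G} in
/-- The right action of `⨁ D j` on `M`: the component `D j`, the opposite of `End (T j)`, acts on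
`G(T j)` from the right through the functor `G`, and on the other summands by zero. -/
def rightAct (m : BiMod T A G) (y : EndRing T) : BiMod T A G :=
  DFinsupp.zipWith (fun j (n : G.obj (T j)) (d : (End (T j))ᵐᵒᵖ) => (G.map d.unop).hom n)
    (fun _ => by simp) m y

variable {T A G} in
@[simp]
lemma rightAct_apply (m : BiMod T A G) (y : EndRing T) (j : J) :
    rightAct m y j = (G.map (y.coeff j).unop).hom (m j) :=
  DFinsupp.zipWith_apply _ _ _ _ _

/-- The triangular matrix ring `R` of all matrices with rows `(y, 0)` and `(m, x)`, where
`y` is in `R_𝒴 = ⨁ D j`, `m` in `M = ⨁ G(T j)` and `x` in `A`. -/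
@[ext]
structure TriRing where
  x : A
  y : EndRing T
  m : BiMod T A G

namespace TriRing

variable {T A G}

instance : Zero (TriRing T A G) := ⟨⟨0, 0, 0⟩⟩
instance : Add (TriRing T A G) := ⟨fun r s => ⟨r.x + s.x, r.y + s.y, r.m + s.m⟩⟩
instance : Neg (TriRing T A G) := ⟨fun r => ⟨-r.x, -r.y, -r.m⟩⟩
instance : Mul (TriRing T A G) :=
  ⟨fun r s => ⟨r.x * s.x, r.y * s.y, rightAct r.m s.y + Plus.of r.x • s.m⟩⟩

@[simp] lemma zero_x : (0 : TriRing T A G).x = 0 := rfl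
@[simp] lemma zero_y : (0 : TriRing T A G).y = 0 := rfl
@[simp] lemma zero_m : (0 : TriRing T A G).m = 0 := rfl
@[simp] lemma add_x (r s : TriRing T A G) : (r + s).x = r.x + s.x := rfl
@[simp] lemma add_y (r s : TriRing T A G) : (r + s).y = r.y + s.y := rfl
@[simp] lemma add_m (r s : TriRing T A G) : (r + s).m = r.m + s.m := rfl
@[simp] lemma neg_x (r : TriRing T A G) : (-r).x = -r.x := rfl
@[simp] lemma neg_y (r : TriRing T A G) : (-r).y = -r.y := rfl
@[simp] lemma neg_m (r : TriRing T A G) : (-r).m = -r.m := rfl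
@[simp] lemma mul_x (r s : TriRing T A G) : (r * s).x = r.x * s.x := rfl
@[simp] lemma mul_y (r s : TriRing T A G) : (r * s).y = r.y * s.y := rfl
@[simp] lemma mul_m (r s : TriRing T A G) :
    (r * s).m = rightAct r.m s.y + Plus.of r.x • s.m := rfl

instance : AddCommGroup (TriRing T A G) where
  add_assoc _ _ _ := by ext1 <;> simp [add_assoc]
  zero_add _ := by ext1 <;> simp
  add_zero _ := by ext1 <;> simp
  neg_add_cancel _ := by ext1 <;> simp
  add_comm _ _ := by ext1 <;> simp [add_comm]
  nsmul := nsmulRec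
  zsmul := zsmulRec

instance [G.Additive] : NonUnitalRing (TriRing T A G) where
  left_distrib r s t := by
    ext1
    · simp [mul_add]
    · simp [mul_add]
    · apply DFinsupp.ext
      intro j
      simp [G.map_add]
      abel
  right_distrib r s t := by
    ext1
    · simp [add_mul]
    · simp [add_mul]
    · apply DFinsupp.ext
      intro j
      simp [map_add, add_smul]
      abel
  zero_mul r := by
    ext1
    · simp
    · simp
    · apply DFinsupp.ext
      intro j
      simp
  mul_zero r := by
    ext1
    · simp
    · simp
    · apply DFinsupp.ext
      intro j
      simp
  mul_assoc r s t := by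
    ext1
    · simp [mul_assoc]
    · simp [mul_assoc]
    · apply DFinsupp.ext
      intro j
      simp [map_mul, mul_smul, End.mul_def]
      abel

end TriRing

/-- The locally finite `R`-modules: as a module over the subring `A ⊕ R_𝒴` of `R`, the module is
the direct sum of a semi-simple `A`-module and of an `R_𝒴`-module of finite length. -/
def locallyFiniteModules [G.Additive] :
    ObjectProperty (ModuleCat.{w'} (Plus (TriRing T A G))) :=
  fun Z => ∃ (X : ModuleCat.{w'} (Plus A)) (Y : ModuleCat.{w'} (Plus (EndRing T)))
    (e : Z ≃+ X × Y), semisimpleModules A X ∧ finiteLengthModules (EndRing T) Y ∧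
      ∀ (x : A) (y : EndRing T) (z : Z),
        e (Plus.of (⟨x, y, 0⟩ : TriRing T A G) • z) =
          (Plus.of x • (e z).1, Plus.of y • (e z).2)

end Triangular

end TorsionExt

end

/-! A triple $(X,Y,\eta)$ is an extension of $(0,Y,0)$ by $(X,0,0)$. A morphism out of $(X,0,0)$ is
only a morphism out of $X$, so this triple is projective because its category of $X$'s is
semi-simple. Dually, $(0,Y,0)$ is injective. The category of triples is abelian because $\mathbf F$
is right exact and the other functor of the comma category is left exact, so that kernels and
cokernels are formed componentwise. In any abelian category a class of degree $n\ge 2$ is a product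
of a class in $\mathrm{Ext}^1(X,K)$ and one in $\mathrm{Ext}^{n-1}(K,Y)$. If $K$ is an extension of
an injective by a projective, the first factor comes from the projective subobject, on which the
second factor vanishes; see `eq_zero_of_projective_of_injective`.

For the modules, let $G$ be $\mathbf F$ followed by the functor $K$ from $\widetilde{\mathcal X}$ to
$R_{\mathcal X}$-modules. The triple is sent to $K(X)\oplus N$ with
$N=\bigoplus_j\mathrm{Hom}(T_j,Y)$, where $M=\bigoplus_j G(T_j)$ acts by
$(m,n)\mapsto\sum_j\eta(G(n_j)(m_j))$. Conversely, the diagonal idempotents of $R$ are local units,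
so a module with $RZ=Z$ splits into a unital $R_{\mathcal X}$-module and a unital $R_{\mathcal
Y}$-module (`exists_isDecomposition`), and all that remains of the action is an $R_{\mathcal
Y}$-balanced pairing of $M$ with the second summand. By Schur's lemma, and since every $Y$ is a
finite sum of simple objects up to summands, modules of finite length over $R_{\mathcal Y}$ are the
modules $N$ above (`exists_linearEquiv`), and their maps come from morphisms. In effect
$M\otimes_{R_{\mathcal Y}}N\cong G(Y)$, so the balanced pairings are exactly the maps $\eta$
(`exists_triMod_equiv`), and module maps are exactly maps of triples (`TriMod.exists_map_eq`).

Submodules are compatible with the splitting, so the module has finite length if and only if both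
summands do. This describes the image of $\mathcal F$. The image of $\widetilde{\mathcal F}$ is
described by the same construction with an arbitrary semi-simple left summand. -/

noncomputable section

/-! ### Effaceability of extension classes and a criterion for heredity -/

namespace CochainComplex

open HomologicalComplex

variable {C : Type u} [Category.{v} C] [Abelian C]

/-- In the top degree $i$ every element of $K^i$ is a cycle, so $K^i\to H^i(K)\cong X$ is an
epimorphism. The object $K^i$, placed in degree $i$, maps to $K$ by the identity because
$K^{i+1}=0$. -/
lemma exists_epi_lift_of_quasiIsoAt
    {X : C} {K : CochainComplex C ℤ} {i : ℤ}
    (π : K ⟶ (single C (ComplexShape.up ℤ) i).obj X) [K.IsStrictlyLE i] [QuasiIsoAt π i] :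
    ∃ (X' : C) (p : X' ⟶ X) (_ : Epi p) (σ : (single C (ComplexShape.up ℤ) i).obj X' ⟶ K),
      σ ≫ π = (single C (ComplexShape.up ℤ) i).map p := by
  have hK : IsZero (K.X (i + 1)) := K.isZero_of_isStrictlyLE i (i + 1) (by simp)
  let e := K.iCyclesIso i (i + 1) (by simp) (hK.eq_of_tgt _ _)
  let α := e.inv ≫ K.homologyπ i ≫ homologyMap π i ≫ (singleObjHomologySelfIso _ _ _).hom
  have hα : π.f i = α ≫ (singleObjXSelf (ComplexShape.up ℤ) i X).inv := by
    rw [← cancel_epi e.hom]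
    dsimp only [α]
    rw [Category.assoc, Category.assoc, Category.assoc, e.hom_inv_id_assoc,
      homologyπ_naturality_assoc, homologyπ_singleObjHomologySelfIso_hom_assoc,
      ← singleObjCyclesSelfIso_inv_iCycles, Iso.hom_inv_id_assoc, cyclesMap_i]
    rfl
  have hα' : Epi α := inferInstance
  refine ⟨K.X i, α, hα', mkHomFromSingle (𝟙 _) ?_, ?_⟩
  · rintro j (hj : i + 1 = j)
    exact (hj ▸ hK : IsZero (K.X j)).eq_of_tgt _ _
  · apply HomologicalComplex.from_single_hom_ext
    rw [comp_f, mkHomFromSingle_f, hα, single_map_f_self]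
    simp

end CochainComplex

namespace DerivedCategory

variable {C : Type u} [Category.{v} C] [Abelian C] [HasDerivedCategory.{w} C]

/-- Write $\varphi$ as a right fraction $\pi^{-1}g$ whose middle complex lives in degrees at most
$i$. After pullback along a suitable epimorphism the denominator $\pi$ is lifted away. What remains
is a genuine chain map from degree $i$ to a complex that is zero there. -/
lemma exists_epi_comp_from_singleFunctor_obj_eq_zero {X : C} {L : CochainComplex C ℤ} {i : ℤ}
    (φ : Q.obj ((CochainComplex.singleFunctor C i).obj X) ⟶ Q.obj L)
    (n : ℤ) (hn : n < i) [L.IsStrictlyLE n] :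
    ∃ (X' : C) (p : X' ⟶ X) (_ : Epi p),
      Q.map ((CochainComplex.singleFunctor C i).map p) ≫ φ = 0 := by
  obtain ⟨K, _, π, h, g, rfl⟩ := right_fac_of_isStrictlyLE φ i
  have : QuasiIsoAt π i := by
    rw [isIso_Q_map_iff_quasiIso] at h
    infer_instance
  obtain ⟨X', p, hp, σ, hσ⟩ :=
    @CochainComplex.exists_epi_lift_of_quasiIsoAt _ _ _ X K i π _ this
  refine ⟨X', p, hp, ?_⟩
  obtain ⟨σ, hσ⟩ : ∃ σ' : (CochainComplex.singleFunctor C i).obj X' ⟶ K,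
      (CochainComplex.singleFunctor C i).map p = σ' ≫ π := ⟨σ, hσ.symm⟩
  have h₂ : σ ≫ g = 0 := by
    apply HomologicalComplex.from_single_hom_ext
    apply (L.isZero_of_isStrictlyLE n i hn).eq_of_tgt
  rw [hσ, Q.map_comp, Category.assoc, IsIso.hom_inv_id_assoc, ← Q.map_comp, h₂, Q.map_zero]

end DerivedCategory

namespace CategoryTheory.Abelian.Ext

open _root_.DerivedCategory

variable {C : Type u} [Category.{v} C] [Abelian C] [HasExt.{w} C]

/-- Classes of positive degree are effaceable. -/
lemma exists_epi_mk₀_comp_eq_zero {X Y : C} {n : ℕ} (e : Ext X Y (n + 1)) :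
    ∃ (X' : C) (p : X' ⟶ X) (_ : Epi p), (Ext.mk₀ p).comp e (zero_add _) = 0 := by
  let := HasDerivedCategory.standard C
  -- The target of a class of degree $n+1$ is $Y$ shifted by $n+1$, which is $Y$ placed in degree
  -- $-(n+1)<0$.
  obtain ⟨X', p, hp, h⟩ := exists_epi_comp_from_singleFunctor_obj_eq_zero
    (L := (CochainComplex.singleFunctor C (-(n + 1))).obj Y) (n := -(n + 1)) (i := 0)
    (e.hom ≫ ((singleFunctors C).shiftIso (n + 1) (-(n + 1)) 0
    (by lia)).hom.app _) (by lia)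
  refine ⟨X', p, hp, ?_⟩
  apply homEquiv.injective
  simp only [← cancel_mono (((singleFunctors C).shiftIso (n + 1) (-(n + 1)) 0
    (by lia)).hom.app _), zero_hom, Limits.zero_comp]
  change ((mk₀ p).comp e (zero_add _)).hom ≫ _ = _
  rw [← singleFunctor_map_comp_hom, Category.assoc]
  exact h

/-- Classes of positive degree factor through a class of degree one. -/
lemma exists_eq_comp {X Y : C} {n : ℕ} (e : Ext X Y (n + 1)) :
    ∃ (K : C) (e₁ : Ext X K 1) (e₂ : Ext K Y n), e₁.comp e₂ (add_comm 1 n) = e := by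
  obtain ⟨X', p, hp, h⟩ := exists_epi_mk₀_comp_eq_zero e
  have hS : (ShortComplex.mk _ _ (kernel.condition p)).ShortExact :=
    { exact := ShortComplex.exact_of_f_is_kernel _ (kernelIsKernel p) }
  -- Since $e$ dies on $X'$, the long exact sequence shows that it is the connecting class of
  -- $0\to\ker p\to X'\to X\to 0$ times a class on $\ker p$.
  obtain ⟨e₂, he₂⟩ := contravariant_sequence_exact₃ hS Y e h (add_comm 1 n)
  exact ⟨_, hS.extClass, e₂, he₂⟩

/-- If every object is an extension of an injective object by a projective object, then the
category is hereditary. -/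
lemma eq_zero_of_projective_of_injective
    (h : ∀ K : C, ∃ S : ShortComplex C,
      S.ShortExact ∧ S.X₂ = K ∧ Projective S.X₁ ∧ Injective S.X₃)
    (X Y : C) (n : ℕ) (hn : 2 ≤ n) (e : Ext X Y n) : e = 0 := by
  obtain ⟨n, rfl⟩ : ∃ m, n = m + 1 + 1 := ⟨n - 2, by lia⟩
  obtain ⟨K, e₁, e₂, rfl⟩ := exists_eq_comp e
  obtain ⟨S, hS, rfl, _, _⟩ := h K
  -- The image of `e₁` in $\mathrm{Ext}^1(X,\text{injective})$ vanishes, so `e₁` comes from the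
  -- projective subobject. There the restriction of `e₂`, of positive degree, is zero.
  obtain ⟨e₁', rfl⟩ := covariant_sequence_exact₂ X hS e₁ (eq_zero_of_injective _)
  rw [comp_assoc_of_second_deg_zero, eq_zero_of_projective ((mk₀ S.f).comp e₂ _), comp_zero]

end CategoryTheory.Abelian.Ext

namespace TorsionExt

/-! ### Splittings in semi-simple categories -/

section Semisimple

variable {A : Type*} [Category* A] [Abelian A]

lemma IsSemisimpleCategory.isSplitEpi (h : IsSemisimpleCategory A) {X Y : A} (f : X ⟶ Y) [Epi f] :
    IsSplitEpi f := by
  have hS : (ShortComplex.mk _ _ (kernel.condition f)).ShortExact :=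
    { exact := ShortComplex.exact_of_f_is_kernel _ (kernelIsKernel f) }
  obtain ⟨s⟩ := h _ hS
  exact ⟨⟨s.s, s.s_g⟩⟩

lemma IsSemisimpleCategory.isSplitMono (h : IsSemisimpleCategory A) {X Y : A} (f : X ⟶ Y)
    [Mono f] : IsSplitMono f := by
  have hS : (ShortComplex.mk _ _ (cokernel.condition f)).ShortExact :=
    { exact := ShortComplex.exact_of_g_is_cokernel _ (cokernelIsCokernel f) }
  obtain ⟨s⟩ := h _ hS
  exact ⟨⟨s.r, s.f_r⟩⟩

/-- An additive functor on a semi-simple category is exact. -/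
lemma IsSemisimpleCategory.preservesFiniteLimits_and_colimits (h : IsSemisimpleCategory A)
    {B : Type*} [Category* B] [Abelian B] (G : A ⥤ B) [G.Additive] :
    PreservesFiniteLimits G ∧ PreservesFiniteColimits G := by
  refine (G.exact_tfae.out 0 3 :).mp fun S hS => ?_
  obtain ⟨s⟩ := h S hS
  exact (s.map G).shortExact

end Semisimple

/-! ### Abelian structure, heredity and projectives for categories of triples -/

section Comma

open ZeroObject

instance {J A B T : Type*} [Category* J] [Category* A] [Category* B] [Category* T] (L : A ⥤ T)
    (R : B ⥤ T) [HasLimitsOfShape J A] [HasLimitsOfShape J B] [PreservesLimitsOfShape J R] :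
    PreservesLimitsOfShape J (Comma.fst L R) where
  preservesLimit := preservesLimit_of_preserves_limit_cone
    (Comma.coneOfPreservesIsLimit _ (limit.isLimit _) (limit.isLimit _)) (limit.isLimit _)

instance {J A B T : Type*} [Category* J] [Category* A] [Category* B] [Category* T] (L : A ⥤ T)
    (R : B ⥤ T) [HasLimitsOfShape J A] [HasLimitsOfShape J B] [PreservesLimitsOfShape J R] :
    PreservesLimitsOfShape J (Comma.snd L R) where
  preservesLimit := preservesLimit_of_preserves_limit_cone
    (Comma.coneOfPreservesIsLimit _ (limit.isLimit _) (limit.isLimit _)) (limit.isLimit _)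

lemma comma_epi_of_epi {A B T : Type*} [Category* A] [Category* B] [Category* T] {L : A ⥤ T}
    {R : B ⥤ T} {X Y : Comma L R} (f : X ⟶ Y) [Epi f.left] [Epi f.right] : Epi f where
  left_cancellation g h w := by
    ext
    · rw [← cancel_epi f.left]; exact congrArg CommaMorphism.left w
    · rw [← cancel_epi f.right]; exact congrArg CommaMorphism.right w

lemma comma_epi_left {A B T : Type*} [Category* A] [Category* B] [Category* T] {L : A ⥤ T}
    {R : B ⥤ T} [HasFiniteColimits A] [HasFiniteColimits B] [PreservesFiniteColimits L]
    {X Y : Comma L R} (f : X ⟶ Y) [Epi f] : Epi f.left :=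
  inferInstanceAs (Epi ((Comma.fst L R).map f))

lemma comma_epi_right {A B T : Type*} [Category* A] [Category* B] [Category* T] {L : A ⥤ T}
    {R : B ⥤ T} [HasFiniteColimits A] [HasFiniteColimits B] [PreservesFiniteColimits L]
    {X Y : Comma L R} (f : X ⟶ Y) [Epi f] : Epi f.right :=
  inferInstanceAs (Epi ((Comma.snd L R).map f))

lemma comma_mono_left {A B T : Type*} [Category* A] [Category* B] [Category* T] {L : A ⥤ T}
    {R : B ⥤ T} [HasFiniteLimits A] [HasFiniteLimits B] [PreservesFiniteLimits R]
    {X Y : Comma L R} (f : X ⟶ Y) [Mono f] : Mono f.left :=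
  inferInstanceAs (Mono ((Comma.fst L R).map f))

/-- As $L(0)=0$, the compatibility condition is vacuous for maps out of $(0,X,0)$. Lifting along an
epimorphism therefore takes place in $B$, where epimorphisms split. -/
lemma comma_projective {A B T : Type*} [Category* A] [Abelian A] [Category* B] [Abelian B]
    [Category* T] [Abelian T] (L : A ⥤ T) [L.Additive] [PreservesFiniteColimits L] {R : B ⥤ T}
    (hB : IsSemisimpleCategory B) (X : B) :
    Projective (⟨0, X, 0⟩ : Comma L R) where
  factors f e _ := by
    have := comma_epi_right e
    obtain ⟨⟨s⟩⟩ := hB.isSplitEpi e.right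
    refine ⟨⟨0, f.right ≫ s.section_, by simp⟩, ?_⟩
    ext
    simp

/-- Dual argument: as $R(0)=0$, only the left component matters, and monomorphisms of $A$ split. -/
lemma comma_injective {A B T : Type*} [Category* A] [Abelian A] [Category* B] [Abelian B]
    [Category* T] [Abelian T] {L : A ⥤ T} (R : B ⥤ T) [R.Additive] [PreservesFiniteLimits R]
    (hA : IsSemisimpleCategory A) (Y : A) :
    Injective (⟨Y, 0, 0⟩ : Comma L R) where
  factors f e _ := by
    have := comma_mono_left e
    obtain ⟨⟨s⟩⟩ := hA.isSplitMono e.left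
    refine ⟨⟨s.retraction ≫ f.left, 0, by simp⟩, ?_⟩
    ext
    simp

variable {A B T : Type*} [Category* A] [Abelian A] [Category* B] [Abelian B] [Category* T]
  [Abelian T] (L : A ⥤ T) [L.Additive] [PreservesFiniteColimits L]
  (R : B ⥤ T) [R.Additive] [PreservesFiniteLimits R]

/-- Both projections preserve kernels and cokernels, hence the comparison between coimage and image.
Its two components are isomorphisms in $A$ and $B$, so it is an isomorphism of triples. -/
instance commaAbelian : Abelian (Comma L R) := by
  haveI : HasFiniteProducts (Comma L R) := hasFiniteProducts_of_hasFiniteLimits _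
  haveI (X Y : Comma L R) (f : X ⟶ Y) : IsIso (Abelian.coimageImageComparison f) := by
    have h₁ : IsIso ((Comma.fst L R).map (Abelian.coimageImageComparison f)) :=
      IsIso.of_isIso_fac_right (Abelian.PreservesCoimage.hom_coimageImageComparison
        (Comma.fst L R) f).symm
    have h₂ : IsIso ((Comma.snd L R).map (Abelian.coimageImageComparison f)) :=
      IsIso.of_isIso_fac_right (Abelian.PreservesCoimage.hom_coimageImageComparison
        (Comma.snd L R) f).symm
    let i := Comma.isoMk (asIso ((Comma.fst L R).map (Abelian.coimageImageComparison f)))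
      (asIso ((Comma.snd L R).map (Abelian.coimageImageComparison f)))
      (Abelian.coimageImageComparison f).w
    exact i.isIso_hom
  exact Abelian.ofCoimageImageComparisonIsIso

variable {L R}

/-- The extension of `(Y, 0)` by `(0, X)` given by a triple `(Y, X, η)`. -/
def commaShortComplex (K : Comma L R) : ShortComplex (Comma L R) where
  X₁ := ⟨0, K.right, 0⟩
  X₂ := K
  X₃ := ⟨K.left, 0, 0⟩
  f := ⟨0, 𝟙 _, by simp⟩
  g := ⟨𝟙 _, 0, by simp⟩
  zero := by
    ext

lemma commaShortComplex_shortExact (K : Comma L R) : (commaShortComplex K).ShortExact := by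
  have h₁ : Mono (commaShortComplex K).f :=
    ⟨fun g h w => by
      have hw : g.right ≫ 𝟙 K.right = h.right ≫ 𝟙 K.right := congrArg CommaMorphism.right w
      ext
      · exact (isZero_zero A).eq_of_tgt _ _
      · exact (Category.comp_id _).symm.trans (hw.trans (Category.comp_id _))⟩
  have h₂ : Epi (commaShortComplex K).g :=
    ⟨fun g h w => by
      have hw : 𝟙 K.left ≫ g.left = 𝟙 K.left ≫ h.left := congrArg CommaMorphism.left w
      ext
      · exact (Category.id_comp _).symm.trans (hw.trans (Category.id_comp _))
      · exact (isZero_zero B).eq_of_src _ _⟩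
  have h₃ : ∀ {W : Comma L R} (k : W ⟶ K) (_ : k ≫ (commaShortComplex K).g = 0),
      k.left = 0 := fun k hk => by
    have hw : k.left ≫ 𝟙 K.left = 0 := congrArg CommaMorphism.left hk
    simpa using hw
  have h₄ : IsLimit (KernelFork.ofι (commaShortComplex K).f (commaShortComplex K).zero) :=
    KernelFork.IsLimit.ofι' _ _ fun {W} k hk => by
      have hk₀ : (show W ⟶ K from k).left = 0 := h₃ k hk
      have hw : L.map (show W ⟶ K from k).left ≫ K.hom = W.hom ≫ R.map k.right := k.w
      rw [hk₀, L.map_zero, zero_comp] at hw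
      -- Once the left component of $k$ is zero, its commutative square reads $W.\mathrm{hom}\circ$
      -- followed by $R(k.\mathrm{right})$ equals zero. That is the condition for a map to the
      -- triple with left component $0$.
      refine ⟨(⟨0, k.right, comp_zero.trans hw⟩ : W ⟶ ⟨0, K.right, 0⟩), ?_⟩
      ext
      · exact (zero_comp.trans (h₃ k hk).symm : (0 : W.left ⟶ 0) ≫ (0 : 0 ⟶ K.left) = k.left)
      · exact Category.comp_id k.right
  exact { exact := ShortComplex.exact_of_f_is_kernel _ h₄ }

variable (L R) in
theorem isHereditaryAbelian_comma (hA : IsSemisimpleCategory A) (hB : IsSemisimpleCategory B) :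
    IsHereditaryAbelian (Comma L R) :=
  ⟨inferInstance, letI := HasExt.standard (Comma L R)
    Abelian.Ext.eq_zero_of_projective_of_injective fun K => ⟨commaShortComplex K,
      commaShortComplex_shortExact K, rfl, comma_projective L hB _, comma_injective R hA _⟩⟩

end Comma

/-- The cover of $(Y,X,\eta)$ is the sum of the free triple $(Y,L(Y),\mathrm{id})$ and $(0,X,0)$. It
requires $L(Y)$ to be an allowed component, hence the identity functor on the right of the comma
category. -/
theorem enoughProjectives_comma {A T : Type*} [Category* A] [Abelian A] [Category* T]
    [Abelian T] (L : A ⥤ T) [L.Additive] [PreservesFiniteColimits L]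
    (hA : IsSemisimpleCategory A) (hT : IsSemisimpleCategory T) :
    EnoughProjectives (Comma L (𝟭 T)) where
  presentation Z := by
    let P : Comma L (𝟭 T) := ⟨Z.left, L.obj Z.left ⊞ Z.right, biprod.inl⟩
    let f : P ⟶ Z :=
      { left := 𝟙 _
        right := biprod.desc Z.hom (𝟙 _)
        w := by simp [P] }
    have : Epi f.right := ⟨fun g h w => by
      simpa [f] using congrArg (biprod.inr ≫ ·) w⟩
    have : Epi f.left := inferInstanceAs (Epi (𝟙 _))
    have hP : Projective P := ⟨fun {W W'} g e _ => by
      have := comma_epi_right e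
      have := comma_epi_left e
      obtain ⟨⟨s⟩⟩ := hA.isSplitEpi e.left
      obtain ⟨⟨t⟩⟩ := hT.isSplitEpi e.right
      -- On the summand $L(Y)$ the lift is forced by its left component; on the other summand it may
      -- be chosen freely, by a section of `e.right`.
      refine ⟨⟨g.left ≫ s.section_, biprod.desc (L.map (g.left ≫ s.section_) ≫ W.hom)
        (biprod.inr ≫ g.right ≫ t.section_), by simp [P]⟩, ?_⟩
      ext
      · simp
      · have h₁ : L.map e.left ≫ W'.hom = W.hom ≫ e.right := e.w
        have h₂ : L.map g.left ≫ W'.hom = biprod.inl ≫ g.right := g.w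
        rw [Comma.comp_right, biprod.inl_desc_assoc, Category.assoc, ← h₁, ← h₂,
          ← L.map_comp_assoc, Category.assoc, s.id, Category.comp_id]
      · rw [Comma.comp_right, biprod.inr_desc_assoc, Category.assoc, Category.assoc, t.id,
            Category.comp_id]⟩
    exact ⟨{ p := P, f := f, epi := comma_epi_of_epi f }⟩

/-! ### Unital modules over rings with local units -/

namespace Plus

section

variable {A : Type*} [NonUnitalRing A] {N N' : Type*} [AddCommGroup N] [Module (Plus A) N]
  [AddCommGroup N'] [Module (Plus A) N']

lemma exists_eq (r : Plus A) : ∃ (k : ℤ) (a : A), r = k • (1 : Plus A) + of a :=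
  ⟨(show Unitization ℤ A from r).fst, (show Unitization ℤ A from r).snd, Unitization.ext
    (show _ = ((show Unitization ℤ A from r).fst • (1 : Unitization ℤ A) +
      Unitization.inr (show Unitization ℤ A from r).snd).fst by simp [-zsmul_eq_mul, -zsmul_one])
    (show _ = ((show Unitization ℤ A from r).fst • (1 : Unitization ℤ A) +
      Unitization.inr (show Unitization ℤ A from r).snd).snd by simp [-zsmul_eq_mul, -zsmul_one])⟩

lemma exists_smul_eq (r : Plus A) : ∃ (k : ℤ) (a : A), r = k • (1 : Plus A) + of a ∧
    ∀ n : N, r • n = k • n + of a • n := by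
  obtain ⟨k, a, rfl⟩ := exists_eq r
  exact ⟨k, a, rfl, fun n => by rw [add_smul, smul_assoc, one_smul]⟩

/-- An additive map which is compatible with the action of `A` is linear over `ℤ ⊕ A`. -/
def linearMap (f : N →+ N') (h : ∀ (a : A) (n : N), f (of a • n) = of a • f n) :
    N →ₗ[Plus A] N' where
  toFun := f
  map_add' := map_add f
  map_smul' r n := by
    obtain ⟨k, a, rfl⟩ := exists_eq r
    simp only [add_smul, smul_assoc, one_smul, map_add, map_zsmul, h, RingHom.id_apply]

/-- An additive bijection which is compatible with the action of `A` is linear over `ℤ ⊕ A`. -/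
def linearEquiv (f : N ≃+ N') (h : ∀ (a : A) (n : N), f (of a • n) = of a • f n) :
    N ≃ₗ[Plus A] N' :=
  { linearMap f.toAddMonoidHom h, f with }

/-- A subgroup stable under `A` is a submodule over `ℤ ⊕ A`. -/
def submodule (U : AddSubgroup N) (h : ∀ (a : A), ∀ n ∈ U, of a • n ∈ U) :
    Submodule (Plus A) N :=
  { U with
    smul_mem' := fun r n hn => by
      obtain ⟨k, a, rfl⟩ := exists_eq r
      rw [add_smul, smul_assoc, one_smul]
      exact U.add_mem (U.zsmul_mem hn k) (h a n hn) }

end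

lemma of_smul_moduleOfAction {A N' : Type*} [NonUnitalRing A] [AddCommGroup N']
    (φ : A →ₙ+* AddMonoid.End N') (a : A) (n : N') :
    letI := moduleOfAction φ
    of a • n = φ a n := by
  change (Unitization.inr a : Unitization ℤ A).fst • n +
    φ (Unitization.inr a : Unitization ℤ A).snd n = φ a n
  simp

end Plus

open Plus

/-- Unital modules over a ring with local units. -/
lemma isUnitalModule_iff_exists {A : Type*} [NonUnitalRing A] {κ : Type*} [Nonempty κ] (e : κ → A)
    (he : ∀ a, ∃ s, e s * a = a) (hdir : ∀ s t, ∃ u, e u * e s = e s ∧ e u * e t = e t)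
    {N : Type*} [AddCommGroup N] [Module (Plus A) N] :
    IsUnitalModule A N ↔ ∀ n : N, ∃ s, of (e s) • n = n := by
  refine ⟨fun h n => ?_, fun h => ?_⟩
  · have hn : n ∈ AddSubgroup.closure {n : N | ∃ (a : A) (m : N), n = Plus.of a • m} := by
      rw [h]; trivial
    induction hn using AddSubgroup.closure_induction with
    | mem x hx =>
      obtain ⟨a, m, rfl⟩ := hx
      obtain ⟨s, hs⟩ := he a
      exact ⟨s, by rw [← mul_smul, ← map_mul, hs]⟩
    | zero => exact ⟨Classical.arbitrary κ, smul_zero _⟩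
    | add x y _ _ hx hy =>
      obtain ⟨s, hs⟩ := hx
      obtain ⟨t, ht⟩ := hy
      -- A sum needs one local unit fixing both terms; directedness supplies it.
      obtain ⟨q, hq, hq'⟩ := hdir s t
      refine ⟨q, ?_⟩
      rw [smul_add]
      nth_rewrite 1 [← hs, ← ht]
      rw [← mul_smul, ← mul_smul, ← map_mul, ← map_mul, hq, hq', hs, ht]
    | neg x _ hx =>
      obtain ⟨s, hs⟩ := hx
      exact ⟨s, by rw [smul_neg, hs]⟩
  · refine (AddSubgroup.eq_top_iff' _).mpr fun n => AddSubgroup.subset_closure ?_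
    obtain ⟨s, hs⟩ := h n
    exact ⟨_, n, hs.symm⟩

/-! ### Unital modules over a direct sum of rings -/

namespace SumRing

open Classical in
/-- The element of `⨁ D i` with only one non-zero component. -/
def single {I : Type*} {D : I → Type*} [∀ i, Ring (D i)] (i : I) (d : D i) : SumRing D :=
  DFinsupp.single i d

open Classical in
/-- The idempotent of `⨁ D i` attached to a finite set of indices. -/
def idem {I : Type*} {D : I → Type*} [∀ i, Ring (D i)] (s : Finset I) : SumRing D :=
  DFinsupp.mk s fun _ => 1

variable {I : Type*} {D : I → Type*} [∀ i, Ring (D i)]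

@[simp]
lemma coeff_single_same (i : I) (d : D i) : (single i d).coeff i = d := by
  classical exact DFinsupp.single_eq_same

lemma coeff_single_of_ne {i j : I} (h : j ≠ i) (d : D i) : (single i d).coeff j = 0 := by
  classical exact DFinsupp.single_eq_of_ne h

open Classical in
lemma coeff_idem (s : Finset I) (i : I) :
    (idem s : SumRing D).coeff i = if i ∈ s then 1 else 0 := by
  simp only [idem, coeff, DFinsupp.mk_apply]
  split_ifs <;> rfl

variable (D) in
/-- The components of an element of `⨁ D i`, as an additive map. -/
def coeffHom (i : I) : SumRing D →+ D i where
  toFun a := a.coeff i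
  map_zero' := rfl
  map_add' _ _ := rfl

lemma single_add (i : I) (d d' : D i) : single i (d + d') = single i d + single i d' := by
  classical exact DFinsupp.single_add _ _ _

lemma single_zero (i : I) : single i (0 : D i) = 0 := by
  classical exact DFinsupp.single_zero _

lemma mul_single (a : SumRing D) (i : I) (d : D i) : a * single i d = single i (a.coeff i * d) := by
  ext j
  by_cases h : j = i
  · subst h; simp
  · simp [coeff_single_of_ne h]

lemma idem_mul {s : Finset I} {a : SumRing D} (h : ∀ i, i ∉ s → a.coeff i = 0) :
    idem s * a = a := by
  ext i
  by_cases hi : i ∈ s <;> simp [coeff_idem, hi, h i]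

lemma exists_idem_mul (a : SumRing D) : ∃ s : Finset I, idem s * a = a := by
  classical
  refine ⟨DFinsupp.support (show Π₀ i, D i from a), idem_mul fun i hi => ?_⟩
  exact DFinsupp.notMem_support_iff.mp hi

lemma idem_mul_idem {s t : Finset I} (h : s ⊆ t) : idem t * (idem s : SumRing D) = idem s :=
  idem_mul fun i hi => by rw [coeff_idem, if_neg fun h' => hi (h h')]

lemma idem_eq_sum (s : Finset I) : (idem s : SumRing D) = ∑ i ∈ s, single i 1 := by
  ext j
  refine Eq.trans ?_ (map_sum (coeffHom D j) _ _).symm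
  change (idem s : SumRing D).coeff j = ∑ i ∈ s, (single i (1 : D i)).coeff j
  rw [coeff_idem]
  split_ifs with h
  · rw [Finset.sum_eq_single_of_mem j h fun i _ hi => coeff_single_of_ne hi.symm _,
      coeff_single_same]
  · exact (Finset.sum_eq_zero fun i hi => coeff_single_of_ne (by rintro rfl; exact h hi) _).symm

section Modules

variable {N : Type*} [AddCommGroup N] [Module (Plus (SumRing D)) N]

lemma isUnitalModule_iff :
    IsUnitalModule (SumRing D) N ↔ ∀ n : N, ∃ s : Finset I, of (idem s : SumRing D) • n = n := by
  classical
  exact isUnitalModule_iff_exists idem exists_idem_mul fun s t =>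
    ⟨s ∪ t, idem_mul_idem Finset.subset_union_left, idem_mul_idem Finset.subset_union_right⟩

/-- Since $n$ is fixed by the unit of $D_i$, both the integer part of $r$ and its part in $\bigoplus
D_i$ act on $n$ through $D_i$. -/
lemma exists_smul_eq_single {n : N} {i : I} (h : of (single i (1 : D i)) • n = n)
    (r : Plus (SumRing D)) : ∃ d : D i, r • n = of (single i d) • n := by
  obtain ⟨k, a, -, hr⟩ := Plus.exists_smul_eq (N := N) r
  refine ⟨k • 1 + a.coeff i, ?_⟩
  have h₁ : of a • n = of (single i (a.coeff i)) • n := by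
    conv_lhs => rw [← h, ← mul_smul, ← map_mul, mul_single, mul_one]
  have h₂ : k • n = of (single i (k • (1 : D i))) • n := by
    have : single i (k • (1 : D i)) = k • single i (1 : D i) := by
      ext j
      change _ = coeffHom D j (k • _)
      rw [map_zsmul]
      change _ = k • (single i (1 : D i)).coeff j
      by_cases hj : j = i
      · subst hj; simp
      · simp [coeff_single_of_ne hj]
    rw [this, map_zsmul, smul_assoc, h]
  rw [hr, h₁, h₂, single_add, map_add, add_smul]

/-- The submodule generated by $n$ is $D_i n$. A non-zero $dn$ generates it again, as a left inverse
of $d$ recovers $n$. -/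
lemma isSimpleModule_span (hD : ∀ (i : I) (d : D i), d ≠ 0 → ∃ d', d' * d = 1) {n : N} {i : I}
    (h : of (single i (1 : D i)) • n = n) (hn : n ≠ 0) :
    IsSimpleModule (Plus (SumRing D)) (Submodule.span (Plus (SumRing D)) {n}) := by
  rw [isSimpleModule_iff_toSpanSingleton_surjective]
  refine ⟨⟨0, ⟨n, Submodule.mem_span_singleton_self n⟩, fun h => hn (congrArg Subtype.val h.symm)⟩,
    ?_⟩
  rintro ⟨m, hm⟩ hm₀ ⟨m', hm'⟩
  obtain ⟨r, rfl⟩ := Submodule.mem_span_singleton.mp hm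
  obtain ⟨r', rfl⟩ := Submodule.mem_span_singleton.mp hm'
  obtain ⟨d, hd⟩ := exists_smul_eq_single h r
  have hd₀ : d ≠ 0 := by
    rintro rfl
    refine hm₀ (Subtype.ext ?_)
    change r • n = 0
    rw [hd, single_zero, map_zero, zero_smul]
  obtain ⟨d', hd'⟩ := hD i d hd₀
  refine ⟨r' * of (single i d'), Subtype.ext ?_⟩
  change (r' * of (single i d')) • r • n = r' • n
  rw [hd, mul_smul, ← mul_smul (of _), ← map_mul, mul_single, coeff_single_same, hd', h]

/-- Every element is a finite sum of its components under the units of the $D_i$, and each component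
is zero or generates a simple submodule. -/
lemma isSemisimpleModule (hD : ∀ (i : I) (d : D i), d ≠ 0 → ∃ d', d' * d = 1)
    (hN : IsUnitalModule (SumRing D) N) :
    IsSemisimpleModule (Plus (SumRing D)) N := by
  refine IsSemisimpleModule.of_sSup_simples_eq_top ((Submodule.eq_top_iff').mpr fun n => ?_)
  obtain ⟨s, hs⟩ := isUnitalModule_iff.mp hN n
  rw [← hs, idem_eq_sum, map_sum, Finset.sum_smul]
  refine Submodule.sum_mem _ fun i _ => ?_
  by_cases hn : of (single i (1 : D i)) • n = 0
  · rw [hn]; exact Submodule.zero_mem _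
  · exact (le_sSup (isSimpleModule_span hD (i := i) (by
      rw [← mul_smul, ← map_mul, mul_single, coeff_single_same, mul_one]) hn) :
        _ ≤ sSup {m : Submodule (Plus (SumRing D)) N | IsSimpleModule _ m})
        (Submodule.mem_span_singleton_self _)

end Modules

end SumRing

/-! ### Finite decompositions into simple objects -/

open Plus

/-- `X` is a direct summand of a finite direct sum of objects of the family `S`. -/
def IsFiniteSummand {𝒜 : Type u} [Category.{v} 𝒜] [Preadditive 𝒜] {I : Type w} (S : I → 𝒜)
    (X : 𝒜) : Prop :=
  ∃ (κ : Type) (_ : Fintype κ) (i : κ → I) (a : ∀ k, S (i k) ⟶ X) (b : ∀ k, X ⟶ S (i k)),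
    ∑ k, b k ≫ a k = 𝟙 X

section Decomposition

variable {𝒜 : Type u} [Category.{v} 𝒜]

lemma IsFiniteSummand.add [Preadditive 𝒜] {I : Type w} {S : I → 𝒜} {X Y : 𝒜}
    (hY : IsFiniteSummand S Y) (s : X ⟶ Y) (r : Y ⟶ X) {i : I} (a : S i ⟶ X) (b : X ⟶ S i)
    (h : b ≫ a + s ≫ r = 𝟙 X) : IsFiniteSummand S X := by
  obtain ⟨κ, _, j, a', b', h'⟩ := hY
  refine ⟨Option κ, inferInstance, fun k => k.elim i j,
    fun k => match k with | none => a | some k => a' k ≫ r,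
    fun k => match k with | none => b | some k => s ≫ b' k, ?_⟩
  rw [Fintype.sum_option, ← h]
  congr 1
  have := congrArg (fun f => s ≫ f ≫ r) h'
  simpa [Preadditive.comp_sum, Preadditive.sum_comp] using this

lemma IsFiniteSummand.of_retract [Preadditive 𝒜] {I : Type w} {S : I → 𝒜} {X Y : 𝒜}
    (hY : IsFiniteSummand S Y) (s : X ⟶ Y) (r : Y ⟶ X) (h : s ≫ r = 𝟙 X) :
    IsFiniteSummand S X := by
  obtain ⟨κ, _, j, a, b, h'⟩ := hY
  refine ⟨κ, inferInstance, j, fun k => a k ≫ r, fun k => s ≫ b k, ?_⟩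
  have := congrArg (fun f => s ≫ f ≫ r) h'
  simpa [Preadditive.comp_sum, Preadditive.sum_comp, h] using this

open ZeroObject in
/-- In a semi-simple category, every artinian object is a finite direct sum of simple objects. -/
theorem IsSimpleRepresentatives.isFiniteSummand [Abelian 𝒜] (hss : IsSemisimpleCategory 𝒜)
    {I : Type w} {S : I → 𝒜} (hS : IsSimpleRepresentatives S) (X : 𝒜) [IsArtinianObject X] :
    IsFiniteSummand S X := by
  suffices h : ∀ U : Subobject X, IsFiniteSummand S (U : 𝒜) from
    (h ⊤).of_retract (inv (⊤ : Subobject X).arrow) (⊤ : Subobject X).arrow (by simp)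
  intro U
  -- Artinian induction: a simple subobject of $U$ splits off, and its complement $\ker r$ is a
  -- strictly smaller subobject of $X$.
  induction U using WellFoundedLT.induction with
  | ind U ih =>
    by_cases hU : IsZero (U : 𝒜)
    · exact ⟨Empty, inferInstance, Empty.elim, Empty.rec, Empty.rec, hU.eq_of_src _ _⟩
    · have : IsArtinianObject (U : 𝒜) := isArtinianObject_of_mono U.arrow
      let m := simpleSubobjectArrow hU
      obtain ⟨⟨r, hr⟩⟩ := hss.isSplitMono m
      obtain ⟨i, ⟨φ⟩⟩ := hS.exhaustive (simpleSubobject hU) inferInstance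
      let V := Subobject.mk (kernel.ι r ≫ U.arrow)
      have hVU : V ≤ U := Subobject.mk_le_of_comm (kernel.ι r) rfl
      -- If the complement were all of $U$, the retraction $r$ would vanish, although it restricts
      -- to the identity of a simple object.
      have hUV : ¬ U ≤ V := fun h => by
        have h₁ : Subobject.ofLEMk U _ h ≫ kernel.ι r = 𝟙 _ := by
          rw [← cancel_mono U.arrow]
          simp
        have h₂ : r = 0 := by
          rw [← Category.id_comp r, ← h₁, Category.assoc, kernel.condition, comp_zero]
        rw [h₂, comp_zero] at hr
        exact id_nonzero (simpleSubobject hU) hr.symm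
      have hk : IsFiniteSummand S (kernel r) :=
        (ih V (lt_of_le_not_ge hVU hUV)).of_retract (Subobject.underlyingIso _).inv
          (Subobject.underlyingIso _).hom (by simp)
      exact hk.add (kernel.lift r (𝟙 _ - r ≫ m) (by simp [hr, m])) (kernel.ι r)
        (φ.inv ≫ m) (r ≫ φ.hom) (by simp)

/-- The inclusion preserves monomorphisms and is fully faithful, so it carries a strictly decreasing
sequence of subobjects to a strictly decreasing one. -/
lemma isArtinianObject_fullSubcategory (P : ObjectProperty 𝒜) [P.ι.PreservesMonomorphisms]
    (X : P.FullSubcategory) [IsArtinianObject X.obj] : IsArtinianObject X := by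
  rw [isArtinianObject_iff_not_strictAnti]
  intro f hf
  refine not_strictAnti_of_isArtinianObject (X := X.obj)
    (fun n => Subobject.mk (P.ι.map (f n).arrow)) fun m n hmn => ?_
  refine lt_of_le_not_ge
    (Subobject.mk_le_mk_of_comm (P.ι.map (Subobject.ofLE _ _ (hf hmn).le)) ?_) fun h => ?_
  · rw [← P.ι.map_comp, Subobject.ofLE_arrow]
  · refine (hf hmn).not_ge (Subobject.le_of_comm (P.ι.preimage (Subobject.ofMkLEMk _ _ h)) ?_)
    apply P.ι.map_injective
    rw [P.ι.map_comp, P.ι.map_preimage, Subobject.ofMkLEMk_comp]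

end Decomposition

/-! ### Objects and modules of finite length over the sum of the rings `D i` -/

namespace HomSum

variable {𝒜 : Type u} [Category.{v} 𝒜] [Preadditive 𝒜] {I : Type w} {S : I → 𝒜}

@[simp]
lemma of_smul {X : 𝒜} (a : EndRing S) (m : HomSum S X) : of a • m = act a m :=
  of_smul_moduleOfAction (actHom S X) a m

open Classical in
/-- The element of `⨁ Hom(S i, X)` with only one non-zero component. -/
def single {X : 𝒜} (i : I) (f : S i ⟶ X) : HomSum S X :=
  DFinsupp.single i f

@[simp]
lemma coeff_single_same {X : 𝒜} (i : I) (f : S i ⟶ X) : (single i f).coeff i = f := by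
  classical exact DFinsupp.single_eq_same

lemma coeff_single_of_ne {X : 𝒜} {i j : I} (h : j ≠ i) (f : S i ⟶ X) :
    (single i f).coeff j = 0 := by
  classical exact DFinsupp.single_eq_of_ne h

@[simp]
lemma single_zero {X : 𝒜} (i : I) : single i (0 : S i ⟶ X) = 0 := by
  classical exact DFinsupp.single_zero _

lemma single_add {X : 𝒜} (i : I) (f g : S i ⟶ X) : single i (f + g) = single i f + single i g := by
  classical exact DFinsupp.single_add _ _ _

lemma single_sum {X : 𝒜} (i : I) {κ : Type*} (s : Finset κ) (f : κ → (S i ⟶ X)) :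
    single i (∑ k ∈ s, f k) = ∑ k ∈ s, single i (f k) :=
  map_sum (⟨⟨single i, single_zero i⟩, single_add i⟩ : (S i ⟶ X) →+ HomSum S X) _ _

lemma coeff_sum {X : 𝒜} (i : I) {κ : Type*} (s : Finset κ) (f : κ → HomSum S X) :
    (∑ k ∈ s, f k).coeff i = ∑ k ∈ s, (f k).coeff i :=
  map_sum (⟨⟨fun m => coeff m i, rfl⟩, fun _ _ => rfl⟩ : HomSum S X →+ (S i ⟶ X)) _ _

@[simp]
lemma map_apply {X Y : 𝒜} (f : X ⟶ Y) (m : HomSum S X) : map f m = mapFun f m := rfl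

lemma act_single {X : 𝒜} (a : EndRing S) (i : I) (f : S i ⟶ X) :
    act a (single i f) = single i ((a.coeff i).unop ≫ f) := by
  ext j
  by_cases h : j = i
  · subst h; simp
  · simp [coeff_single_of_ne h]

lemma act_ringSingle {X : 𝒜} (i : I) (d : (End (S i))ᵐᵒᵖ) (m : HomSum S X) :
    act (SumRing.single i d : EndRing S) m = single i (d.unop ≫ m.coeff i) := by
  ext j
  by_cases h : j = i
  · subst h; simp
  · simp [coeff_single_of_ne h, SumRing.coeff_single_of_ne h]

lemma mapFun_single {X Y : 𝒜} (g : X ⟶ Y) (i : I) (f : S i ⟶ X) :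
    mapFun g (single i f) = single i (f ≫ g) := by
  ext j
  by_cases h : j = i
  · subst h; simp
  · simp [coeff_single_of_ne h]

lemma mapFun_add {X Y : 𝒜} (f g : X ⟶ Y) (m : HomSum S X) :
    mapFun (f + g) m = mapFun f m + mapFun g m := by
  ext j
  simp

lemma isUnitalModule (X : 𝒜) : IsUnitalModule (EndRing S) (HomSum S X) := by
  classical
  refine SumRing.isUnitalModule_iff.mpr fun m =>
    ⟨DFinsupp.support (show Π₀ i, (S i ⟶ X) from m), ?_⟩
  ext i
  rw [of_smul, coeff_act, SumRing.coeff_idem]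
  split_ifs with h
  · exact Category.id_comp _
  · rw [show m.coeff i = 0 from DFinsupp.notMem_support_iff.mp h, comp_zero]

instance : (homFunctor S).Additive where
  map_add {X Y f g} := by
    apply ModuleCat.hom_ext
    apply LinearMap.ext
    exact mapFun_add f g

end HomSum

open HomSum

namespace IsSimpleRepresentatives

variable {𝒜 : Type u} [Category.{v} 𝒜] {I : Type w} {S : I → 𝒜}

section Preadditive

variable [Preadditive 𝒜]

/-- Schur's lemma: a non-zero map between simple objects is an isomorphism, and distinct
representatives are not isomorphic. -/
lemma eq_zero [HasKernels 𝒜] (hS : IsSimpleRepresentatives S) {i j : I} (h : i ≠ j)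
    (f : S i ⟶ S j) : f = 0 := by
  by_contra hf
  have := hS.simple i
  have := hS.simple j
  have := isIso_of_hom_simple hf
  exact h (hS.injective i j ⟨asIso f⟩)

lemma exists_mul_eq_one [HasKernels 𝒜] (hS : IsSimpleRepresentatives S) (i : I)
    (d : (End (S i))ᵐᵒᵖ) (hd : d ≠ 0) : ∃ d', d' * d = 1 := by
  have := hS.simple i
  have h : (show S i ⟶ S i from d.unop) ≠ 0 := fun h => hd (MulOpposite.unop_injective h)
  have := isIso_of_hom_simple h
  exact ⟨MulOpposite.op (inv (show S i ⟶ S i from d.unop)),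
    MulOpposite.unop_injective (IsIso.inv_hom_id (show S i ⟶ S i from d.unop))⟩

/-- The values on the elements of the summand `i` determine a linear map. -/
lemma coeff_map_single [HasKernels 𝒜] (hS : IsSimpleRepresentatives S) {X Y : 𝒜}
    (φ : HomSum S X →ₗ[Plus (EndRing S)] HomSum S Y) {i j : I}
    (f : S j ⟶ S i) (a : S i ⟶ X) :
    (φ (single j (f ≫ a))).coeff j = f ≫ (φ (single i a)).coeff i := by
  -- For $j=i$ the morphism $f$ is a scalar in $D_i$ and this is linearity. For $j\ne i$ both sides
  -- vanish by Schur's lemma.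
  by_cases h : j = i
  · subst h
    have := φ.map_smul (of (SumRing.single j (MulOpposite.op (show End (S j) from f))))
      (single j a)
    rw [of_smul, of_smul, act_single] at this
    have := congrArg (fun m => HomSum.coeff m j) this
    simpa using this
  · rw [hS.eq_zero h f]
    simp

/-- Linearity with respect to the unit of $D_j$: a linear map respects the decomposition into
summands. -/
lemma coeff_map_single_self {X Y : 𝒜} (φ : HomSum S X →ₗ[Plus (EndRing S)] HomSum S Y)
    (m : HomSum S X) (j : I) :
    (φ (single j (m.coeff j))).coeff j = (φ m).coeff j := by
  have := φ.map_smul (of (SumRing.single j (1 : (End (S j))ᵐᵒᵖ))) m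
  rw [of_smul, of_smul, act_ringSingle, act_ringSingle] at this
  have := congrArg (fun m => HomSum.coeff m j) this
  simpa [End.one_def] using this

/-- Linear maps on `⨁ Hom(S i, X)` come from morphisms. -/
lemma exists_map_eq [HasKernels 𝒜] (hS : IsSimpleRepresentatives S) {X Y : 𝒜}
    (hX : IsFiniteSummand S X)
    (φ : HomSum S X →ₗ[Plus (EndRing S)] HomSum S Y) : ∃ g : X ⟶ Y, HomSum.map g = φ := by
  obtain ⟨κ, _, i, a, b, h⟩ := hX
  -- The morphism $a_k$ followed by $g$ has to be the value of `φ` at $a_k$; the relation $\sum_k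
  -- b_k a_k=1$ then leaves this as the only candidate for $g$.
  refine ⟨∑ k, b k ≫ (φ (single (i k) (a k))).coeff (i k), ?_⟩
  ext m j
  rw [map_apply, coeff_mapFun, Preadditive.comp_sum, ← coeff_map_single_self φ m j]
  nth_rewrite 2 [← Category.comp_id (m.coeff j)]
  rw [← h, Preadditive.comp_sum, single_sum, map_sum, coeff_sum]
  refine Finset.sum_congr rfl fun k _ => ?_
  rw [← Category.assoc, ← Category.assoc, hS.coeff_map_single]

lemma map_injective {X Y : 𝒜} (hX : IsFiniteSummand S X) {f g : X ⟶ Y}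
    (hfg : HomSum.map (S := S) f = HomSum.map g) : f = g := by
  obtain ⟨κ, _, i, a, b, h⟩ := hX
  rw [← Category.id_comp f, ← Category.id_comp g, ← h, Preadditive.sum_comp, Preadditive.sum_comp]
  refine Finset.sum_congr rfl fun k _ => ?_
  have := congrArg (fun φ => HomSum.coeff (φ (single (i k) (a k))) (i k)) hfg
  simp only [map_apply, coeff_mapFun, coeff_single_same] at this
  rw [Category.assoc, Category.assoc, this]

/-- By Schur's lemma only the summand $\mathrm{Hom}(S_i,S_i)$ survives, and it is generated over
$D_i$ by the identity. -/
lemma isSimpleModule_homSum [HasKernels 𝒜] (hS : IsSimpleRepresentatives S) (i : I) :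
    IsSimpleModule (Plus (EndRing S)) (HomSum S (S i)) := by
  have := hS.simple i
  have h₁ : of (SumRing.single i (1 : (End (S i))ᵐᵒᵖ) : EndRing S) • single i (𝟙 (S i)) =
      single i (𝟙 (S i)) := by
    rw [of_smul, act_single]
    simp [End.one_def]
  have h₂ : single i (𝟙 (S i)) ≠ 0 := fun h => by
    have := congrArg (fun m => HomSum.coeff m i) h
    exact id_nonzero (S i) (by simpa using this)
  have h₃ := SumRing.isSimpleModule_span hS.exists_mul_eq_one h₁ h₂
  have h₄ : Submodule.span (Plus (EndRing S)) {single i (𝟙 (S i))} = ⊤ := by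
    rw [Submodule.eq_top_iff']
    intro m
    refine Submodule.mem_span_singleton.mpr
      ⟨of (SumRing.single i (MulOpposite.op (m.coeff i))), ?_⟩
    rw [of_smul, act_single]
    ext j
    by_cases h : j = i
    · subst h; simp
    · rw [coeff_single_of_ne h, hS.eq_zero h (m.coeff j)]
  rw [h₄] at h₃
  exact IsSimpleModule.congr Submodule.topEquiv.symm

/-- A simple module over `⨁ D i` is isomorphic to some `⨁ Hom(S j, S i)`. -/
lemma exists_linearEquiv_of_isSimpleModule [HasKernels 𝒜] (hS : IsSimpleRepresentatives S)
    {N : Type*} [AddCommGroup N]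
    [Module (Plus (EndRing S)) N] (hN : IsUnitalModule (EndRing S) N)
    [IsSimpleModule (Plus (EndRing S)) N] :
    ∃ i, Nonempty (HomSum S (S i) ≃ₗ[Plus (EndRing S)] N) := by
  have := IsSimpleModule.nontrivial (Plus (EndRing S)) N
  obtain ⟨n, hn⟩ := exists_ne (0 : N)
  obtain ⟨i, hi⟩ : ∃ i, of (SumRing.single i (1 : (End (S i))ᵐᵒᵖ) : EndRing S) • n ≠ 0 := by
    by_contra! h
    obtain ⟨s, hs⟩ := SumRing.isUnitalModule_iff.mp hN n
    rw [SumRing.idem_eq_sum, map_sum, Finset.sum_smul, Finset.sum_eq_zero fun i _ => h i] at hs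
    exact hn hs.symm
  -- The map $d\mapsto dn$ from $D_i$ to $N$. It is non-zero because its value at the identity is,
  -- and a non-zero map between simple modules is bijective.
  let φ : HomSum S (S i) →ₗ[Plus (EndRing S)] N := Plus.linearMap
    { toFun := fun m => of (SumRing.single i (MulOpposite.op (m.coeff i)) : EndRing S) • n
      map_zero' := by simp [SumRing.single_zero]
      map_add' := fun m m' => by
        rw [coeff_add, MulOpposite.op_add, SumRing.single_add, map_add, add_smul] } (by
    intro a m
    change of (SumRing.single i _ : EndRing S) • n = of a • of (SumRing.single i _ : EndRing S) • n
    rw [← mul_smul, ← map_mul, SumRing.mul_single, of_smul, coeff_act]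
    rfl)
  have hφ : φ ≠ 0 := fun h => hi <| by
    have := LinearMap.congr_fun h (single i (𝟙 (S i)))
    change of (SumRing.single i (MulOpposite.op ((single i (𝟙 (S i))).coeff i)) : EndRing S) • n
      = 0 at this
    rwa [coeff_single_same] at this
  have := hS.isSimpleModule_homSum i
  exact ⟨i, ⟨LinearEquiv.ofBijective φ (LinearMap.bijective_of_ne_zero hφ)⟩⟩

/-- The module of $X$ is a quotient of a finite product of simple modules, because the identity of
$X$ factors through the corresponding sum of simple objects. -/
lemma isFiniteLength_homSum [HasKernels 𝒜] (hS : IsSimpleRepresentatives S) {X : 𝒜}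
    (hX : IsFiniteSummand S X) :
    IsFiniteLength (Plus (EndRing S)) (HomSum S X) := by
  obtain ⟨κ, _, i, a, b, h⟩ := hX
  have (k : κ) := hS.isSimpleModule_homSum (i k)
  have h₁ : IsFiniteLength (Plus (EndRing S)) (∀ k, HomSum S (S (i k))) :=
    isFiniteLength_iff_isNoetherian_isArtinian.mpr ⟨inferInstance, inferInstance⟩
  refine h₁.of_surjective (f := ∑ k, (HomSum.map (a k)).comp (LinearMap.proj k)) fun m =>
    ⟨fun k => HomSum.map (b k) m, ?_⟩
  ext j
  simp only [LinearMap.sum_apply, coeff_sum, LinearMap.comp_apply, LinearMap.proj_apply,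
    map_apply, coeff_mapFun, Category.assoc]
  rw [← Preadditive.comp_sum, h, Category.comp_id]

end Preadditive

/-- Every module of finite length over `⨁ D i` is of the form `⨁ Hom(S i, X)`. -/
theorem exists_linearEquiv [Abelian 𝒜] (hS : IsSimpleRepresentatives S) {N : Type*} [AddCommGroup N]
    [Module (Plus (EndRing S)) N] (hN : IsUnitalModule (EndRing S) N)
    (hN' : IsFiniteLength (Plus (EndRing S)) N) :
    ∃ X : 𝒜, Nonempty (HomSum S X ≃ₗ[Plus (EndRing S)] N) := by
  obtain ⟨_, _⟩ := isFiniteLength_iff_isNoetherian_isArtinian.mp hN'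
  -- Semi-simplicity is automatic for a unital module here; finite length is used to make the sum of
  -- simple modules finite.
  have := SumRing.isSemisimpleModule hS.exists_mul_eq_one hN
  obtain ⟨n, V, e, hV⟩ :=
    IsSemisimpleModule.exists_linearEquiv_fin_dfinsupp (Plus (EndRing S)) N
  have hV' (k : Fin n) : ∃ i, Nonempty (HomSum S (S i) ≃ₗ[Plus (EndRing S)] V k) := by
    have := hV k
    refine hS.exists_linearEquiv_of_isSimpleModule (SumRing.isUnitalModule_iff.mpr fun x => ?_)
    obtain ⟨s, hs⟩ := SumRing.isUnitalModule_iff.mp hN x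
    exact ⟨s, Subtype.ext hs⟩
  choose i hi using hV'
  have := Abelian.hasFiniteBiproducts (C := 𝒜)
  refine ⟨⨁ fun k => S (i k), ⟨?_⟩⟩
  let φ : HomSum S (⨁ fun k => S (i k)) →ₗ[Plus (EndRing S)] ∀ k, HomSum S (S (i k)) :=
    LinearMap.pi fun k => HomSum.map (biproduct.π (fun k => S (i k)) k)
  have hφ : Function.Bijective φ := by
    constructor
    · intro m m' h
      refine HomSum.ext fun j => biproduct.hom_ext _ _ fun k => ?_
      have := congrArg (fun m => HomSum.coeff m j) (congrFun h k)
      simpa [φ] using this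
    · intro m
      refine ⟨∑ k, HomSum.map (biproduct.ι (fun k => S (i k)) k) (m k), ?_⟩
      ext k j
      simp only [φ, LinearMap.pi_apply, map_apply, coeff_mapFun, coeff_sum, Preadditive.sum_comp,
        Category.assoc]
      rw [Finset.sum_eq_single_of_mem k (Finset.mem_univ k) fun l _ hl => by
        rw [biproduct.ι_π_ne _ hl, comp_zero]]
      simp
  exact (LinearEquiv.ofBijective φ hφ).trans <|
    (LinearEquiv.piCongrRight fun k => (hi k).some).trans <|
    DFinsupp.linearEquivFunOnFintype.symm.trans e.symm

end IsSimpleRepresentatives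

open Plus

/-! ### The bimodule, the balanced pairing and the module of a triple -/

section BiMod

variable {𝒴 : Type u} [Category.{v} 𝒴] {J : Type w} {T : J → 𝒴}
  {A : Type u'} [NonUnitalRing A] {G : 𝒴 ⥤ ModuleCat.{v'} (Plus A)}

open Classical in
/-- The element of `⨁ G(T j)` with only one non-zero component. -/
def biSingle (j : J) (g : G.obj (T j)) : BiMod T A G := DFinsupp.single j g

lemma biSingle_add (j : J) (g g' : G.obj (T j)) :
    (biSingle j (g + g') : BiMod T A G) = biSingle j g + biSingle j g' := by
  classical exact DFinsupp.single_add _ _ _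

@[simp]
lemma biSingle_zero (j : J) : (biSingle j (0 : G.obj (T j)) : BiMod T A G) = 0 := by
  classical exact DFinsupp.single_zero _

@[simp]
lemma biSingle_same (j : J) (g : G.obj (T j)) : (biSingle j g : BiMod T A G) j = g := by
  classical exact DFinsupp.single_eq_same

lemma biSingle_of_ne {i j : J} (h : i ≠ j) (g : G.obj (T j)) :
    (biSingle j g : BiMod T A G) i = 0 := by
  classical exact DFinsupp.single_eq_of_ne h

lemma smul_biSingle (r : Plus A) (j : J) (g : G.obj (T j)) :
    r • (biSingle j g : BiMod T A G) = biSingle j (r • g) := by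
  classical exact (DFinsupp.single_smul _ _).symm

lemma BiMod.induction {p : BiMod T A G → Prop} (m : BiMod T A G) (zero : p 0)
    (add : ∀ m m', p m → p m' → p (m + m')) (single : ∀ j g, p (biSingle j g)) : p m := by
  classical exact DFinsupp.induction m zero fun j g m' _ _ h => add _ _ (single j g) h

lemma BiMod.isUnitalModule (hG : ∀ j, IsUnitalModule A (G.obj (T j))) :
    IsUnitalModule A (BiMod T A G) := by
  refine (AddSubgroup.eq_top_iff' _).mpr fun m => ?_
  induction m using BiMod.induction with
  | zero => exact AddSubgroup.zero_mem _
  | add m m' h h' => exact AddSubgroup.add_mem _ h h'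
  | single j g =>
    have hg : g ∈ AddSubgroup.closure
        {n : G.obj (T j) | ∃ (a : A) (m : G.obj (T j)), n = Plus.of a • m} := by
      rw [hG j]; trivial
    induction hg using AddSubgroup.closure_induction with
    | mem x hx =>
      obtain ⟨a, g', rfl⟩ := hx
      exact AddSubgroup.subset_closure ⟨a, biSingle j g', (smul_biSingle _ _ _).symm⟩
    | zero => rw [biSingle_zero]; exact AddSubgroup.zero_mem _
    | add x y _ _ hx hy => rw [biSingle_add]; exact AddSubgroup.add_mem _ hx hy
    | neg x _ hx =>
      rw [show (biSingle j (-x) : BiMod T A G) = -biSingle j x by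
        rw [eq_neg_iff_add_eq_zero, ← biSingle_add, neg_add_cancel, biSingle_zero]]
      exact AddSubgroup.neg_mem _ hx

variable [Preadditive 𝒴]

lemma rightAct_add (m m' : BiMod T A G) (y : EndRing T) :
    rightAct (m + m') y = rightAct m y + rightAct m' y := by
  ext1 j; simp

@[simp]
lemma rightAct_zero_left (y : EndRing T) : rightAct (0 : BiMod T A G) y = 0 := by
  ext1 j; simp

@[simp]
lemma rightAct_zero_right [G.Additive] (m : BiMod T A G) : rightAct m (0 : EndRing T) = 0 := by
  ext1 j; simp

lemma rightAct_biSingle (j : J) (g : G.obj (T j)) (y : EndRing T) :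
    rightAct (biSingle j g : BiMod T A G) y = biSingle j ((G.map (y.coeff j).unop).hom g) := by
  ext1 i
  by_cases h : i = j
  · subst h; simp
  · simp [biSingle_of_ne h]

lemma exists_rightAct_idem [G.Additive] (m : BiMod T A G) :
    ∃ t : Finset J, rightAct m (SumRing.idem t) = m := by
  classical
  refine ⟨m.support, ?_⟩
  ext1 j
  rw [rightAct_apply, SumRing.coeff_idem]
  split_ifs with h
  · rw [MulOpposite.unop_one, End.one_def, G.map_id]; rfl
  · rw [DFinsupp.notMem_support_iff.mp h, map_zero]

/-! ### The pairing attached to a triple -/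

open Classical in
/-- The pairing `(m, n) ↦ ∑ η(G(n j)(m j))`. -/
def pair {Y : 𝒴} {X : Type*} [AddCommGroup X] [Module (Plus A) X]
    (η : G.obj Y →ₗ[Plus A] X) (m : BiMod T A G) (n : HomSum T Y) : X :=
  DFinsupp.sumAddHom
    (fun j => η.toAddMonoidHom.comp (G.map (n.coeff j)).hom.toAddMonoidHom) m

section pair

variable {Y : 𝒴} {X : Type*} [AddCommGroup X] [Module (Plus A) X] (η : G.obj Y →ₗ[Plus A] X)

@[simp]
lemma pair_biSingle (j : J) (g : G.obj (T j)) (n : HomSum T Y) :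
    pair η (biSingle j g : BiMod T A G) n = η ((G.map (n.coeff j)).hom g) := by
  classical exact DFinsupp.sumAddHom_single _ _ _

@[simp]
lemma pair_zero_left (n : HomSum T Y) : pair η (0 : BiMod T A G) n = 0 := by
  simp [pair]

lemma pair_add_left (m m' : BiMod T A G) (n : HomSum T Y) :
    pair η (m + m') n = pair η m n + pair η m' n := by
  simp [pair]

lemma pair_add_right [G.Additive] (m : BiMod T A G) (n n' : HomSum T Y) :
    pair η m (n + n') = pair η m n + pair η m n' := by
  induction m using BiMod.induction with
  | zero => simp
  | add m m' h h' => simp only [pair_add_left, h, h']; abel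
  | single j g => simp [G.map_add]

@[simp]
lemma pair_zero_right [G.Additive] (m : BiMod T A G) : pair η m (0 : HomSum T Y) = 0 := by
  simpa using pair_add_right η m 0 0

lemma pair_smul (r : Plus A) (m : BiMod T A G) (n : HomSum T Y) :
    pair η (r • m) n = r • pair η m n := by
  induction m using BiMod.induction with
  | zero => simp
  | add m m' h h' => simp only [smul_add, pair_add_left, h, h']
  | single j g => simp [smul_biSingle]

/-- The pairing is balanced over $R_{\mathcal Y}$ by functoriality of $G$. Together with
`pair_smul`, this makes the matrix action associative. -/
lemma pair_rightAct (m : BiMod T A G) (y : EndRing T) (n : HomSum T Y) :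
    pair η (rightAct m y) n = pair η m (HomSum.act y n) := by
  induction m using BiMod.induction with
  | zero => simp
  | add m m' h h' => simp only [rightAct_add, pair_add_left, h, h']
  | single j g => simp [rightAct_biSingle]

/-- Naturality of the pairing: this is why a morphism of triples induces a map linear over the
bimodule part as well as over the diagonal. -/
lemma pair_map {Y' : 𝒴} {X' : Type*} [AddCommGroup X'] [Module (Plus A) X']
    {η' : G.obj Y' →ₗ[Plus A] X'} {f : X →ₗ[Plus A] X'} {g : Y ⟶ Y'}
    (h : f ∘ₗ η = η' ∘ₗ (G.map g).hom) (m : BiMod T A G) (n : HomSum T Y) :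
    f (pair η m n) = pair η' m (HomSum.mapFun g n) := by
  induction m using BiMod.induction with
  | zero => simp
  | add m m' h h' => simp only [pair_add_left, map_add, h, h']
  | single j x => simpa using LinearMap.congr_fun h ((G.map (n.coeff j)).hom x)

end pair

/-! ### The module attached to a triple -/

variable (T) in
/-- The module over the triangular matrix ring attached to a triple `(X, Y, η)`. -/
def TriMod {Y : 𝒴} {X : Type*} [AddCommGroup X] [Module (Plus A) X]
    (_ : G.obj Y →ₗ[Plus A] X) := X × HomSum T Y

namespace TriMod

variable {Y : 𝒴} {X : Type*} [AddCommGroup X] [Module (Plus A) X] (η : G.obj Y →ₗ[Plus A] X)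

instance : AddCommGroup (TriMod T η) := inferInstanceAs (AddCommGroup (X × HomSum T Y))

variable (T) in
/-- The decomposition of the underlying group. -/
def equiv : TriMod T η ≃+ X × HomSum T Y := AddEquiv.refl _

variable {η} in
lemma ext' {p q : TriMod T η} (h₁ : (equiv T η p).1 = (equiv T η q).1)
    (h₂ : (equiv T η p).2 = (equiv T η q).2) : p = q :=
  Prod.ext h₁ h₂

/-- The action of the triangular matrix ring. -/
def act (r : TriRing T A G) (p : TriMod T η) : TriMod T η :=
  (equiv T η).symm (of r.x • (equiv T η p).1 + pair η r.m (equiv T η p).2,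
    HomSum.act r.y (equiv T η p).2)

lemma equiv_act (r : TriRing T A G) (p : TriMod T η) :
    equiv T η (act η r p) = (of r.x • (equiv T η p).1 + pair η r.m (equiv T η p).2,
      of r.y • (equiv T η p).2) := by
  rw [HomSum.of_smul]; rfl

variable [G.Additive]

variable (T) in
/-- The action of the triangular matrix ring, as a ring homomorphism. -/
def actHom : TriRing T A G →ₙ+* AddMonoid.End (TriMod T η) where
  toFun r :=
    { toFun := act η r
      map_zero' := by
        apply (equiv T η).injective
        rw [equiv_act]
        simp
      map_add' := fun p q => by
        apply (equiv T η).injective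
        rw [map_add, equiv_act, equiv_act, equiv_act, map_add, Prod.fst_add, Prod.snd_add,
          smul_add, smul_add, pair_add_right, Prod.mk_add_mk]
        congr 1
        abel }
  map_zero' := by
    refine AddMonoidHom.ext fun p => (equiv T η).injective ?_
    change equiv T η (act η 0 p) = equiv T η 0
    rw [equiv_act]
    simp
  map_add' r s := by
    refine AddMonoidHom.ext fun p => (equiv T η).injective ?_
    change equiv T η (act η (r + s) p) = equiv T η (act η r p + act η s p)
    rw [map_add, equiv_act, equiv_act, equiv_act, TriRing.add_x, TriRing.add_m, TriRing.add_y,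
      map_add, map_add, add_smul, add_smul, pair_add_left, Prod.mk_add_mk]
    congr 1
    abel
  map_mul' r s := by
    refine AddMonoidHom.ext fun p => (equiv T η).injective ?_
    change equiv T η (act η (r * s) p) = equiv T η (act η r (act η s p))
    rw [equiv_act, equiv_act, equiv_act, TriRing.mul_x, TriRing.mul_m, TriRing.mul_y,
      map_mul, map_mul, mul_smul, mul_smul, pair_add_left, pair_rightAct, pair_smul, smul_add,
      HomSum.of_smul s.y]
    congr 1
    abel

instance : Module (Plus (TriRing T A G)) (TriMod T η) := moduleOfAction (actHom T η)

lemma equiv_of_smul (r : TriRing T A G) (p : TriMod T η) :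
    equiv T η (of r • p) = (of r.x • (equiv T η p).1 + pair η r.m (equiv T η p).2,
      of r.y • (equiv T η p).2) := by
  rw [of_smul_moduleOfAction (actHom T η) r p]
  exact equiv_act η r p

lemma equiv_of_diagonal_smul (x : A) (y : EndRing T) (p : TriMod T η) :
    equiv T η (of (⟨x, y, 0⟩ : TriRing T A G) • p) =
      (of x • (equiv T η p).1, of y • (equiv T η p).2) := by
  rw [equiv_of_smul, pair_zero_left, add_zero]

variable {η}

/-- Functoriality of the module attached to a triple. -/
def map {Y' : 𝒴} {X' : Type*} [AddCommGroup X'] [Module (Plus A) X']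
    {η' : G.obj Y' →ₗ[Plus A] X'} (f : X →ₗ[Plus A] X') (g : Y ⟶ Y')
    (h : f ∘ₗ η = η' ∘ₗ (G.map g).hom) : TriMod T η →ₗ[Plus (TriRing T A G)] TriMod T η' :=
  Plus.linearMap
    ((equiv T η').symm.toAddMonoidHom.comp <|
      (AddMonoidHom.prodMap f.toAddMonoidHom (HomSum.mapAdd g)).comp (equiv T η).toAddMonoidHom)
    fun r p => by
      apply (equiv T η').injective
      rw [equiv_of_smul]
      change (f (equiv T η (of r • p)).1, HomSum.map g (equiv T η (of r • p)).2) =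
        (of r.x • f (equiv T η p).1 + pair η' r.m (HomSum.map g (equiv T η p).2),
          of r.y • HomSum.map g (equiv T η p).2)
      rw [equiv_of_smul, map_add, map_smul, map_smul, pair_map η h]
      rfl

lemma equiv_map {Y' : 𝒴} {X' : Type*} [AddCommGroup X'] [Module (Plus A) X']
    {η' : G.obj Y' →ₗ[Plus A] X'} (f : X →ₗ[Plus A] X') (g : Y ⟶ Y')
    (h : f ∘ₗ η = η' ∘ₗ (G.map g).hom) (p : TriMod T η) :
    equiv T η' (map f g h p) = (f (equiv T η p).1, HomSum.map g (equiv T η p).2) := rfl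

end TriMod

end BiMod

open Plus

variable {𝒴 : Type u} [Category.{v} 𝒴] [Preadditive 𝒴] {J : Type w} {T : J → 𝒴}

/-! ### Local units of the triangular matrix ring -/

namespace TriRing

variable {I : Type*} {D : I → Type*} [∀ i, Ring (D i)]
  {G : 𝒴 ⥤ ModuleCat.{v'} (Plus (SumRing D))}

/-- The element `m` of the bimodule, as an element of the triangular matrix ring. -/
def ofM (m : BiMod T (SumRing D) G) : TriRing T (SumRing D) G := ⟨0, 0, m⟩

/-- The diagonal idempotent attached to two finite sets of indices. -/
def idem (s : Finset I) (t : Finset J) : TriRing T (SumRing D) G :=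
  ⟨SumRing.idem s, SumRing.idem t, 0⟩

lemma eq_add_ofM (r : TriRing T (SumRing D) G) : r = ⟨r.x, r.y, 0⟩ + ofM r.m := by
  ext1 <;> simp [ofM]

lemma ofM_add (m m' : BiMod T (SumRing D) G) : ofM (m + m') = ofM m + ofM m' := by
  ext1 <;> simp [ofM]

lemma ofM_mul (x : SumRing D) (y : EndRing T) (m : BiMod T (SumRing D) G) :
    ofM m * ⟨x, y, 0⟩ = ofM (rightAct m y) := by
  ext1 <;> simp [ofM]

lemma idem_mul_idem {s s' : Finset I} {t t' : Finset J} (hs : s ⊆ s') (ht : t ⊆ t') :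
    idem s' t' * idem s t = (idem s t : TriRing T (SumRing D) G) := by
  ext1 <;> simp [idem, SumRing.idem_mul_idem hs, SumRing.idem_mul_idem ht]

variable [G.Additive]

lemma mul_ofM (x : SumRing D) (y : EndRing T) (m : BiMod T (SumRing D) G) :
    ⟨x, y, 0⟩ * ofM m = ofM (of x • m) := by
  ext1 <;> simp [ofM]

lemma exists_idem_mul_ofM (hG : ∀ j, IsUnitalModule (SumRing D) (G.obj (T j)))
    (m : BiMod T (SumRing D) G) :
    ∃ s : Finset I, (⟨SumRing.idem s, 0, 0⟩ : TriRing T (SumRing D) G) * ofM m = ofM m := by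
  obtain ⟨s, hs⟩ := SumRing.isUnitalModule_iff.mp (BiMod.isUnitalModule hG) m
  exact ⟨s, by rw [mul_ofM, hs]⟩

lemma exists_ofM_mul_idem (m : BiMod T (SumRing D) G) :
    ∃ t : Finset J, ofM m * (⟨0, SumRing.idem t, 0⟩ : TriRing T (SumRing D) G) = ofM m := by
  obtain ⟨t, ht⟩ := exists_rightAct_idem m
  exact ⟨t, by rw [ofM_mul, ht]⟩

/-- The diagonal idempotents are left local units. For the entry in the bimodule this uses that each
$G(T_j)$ is unital over the left diagonal ring. -/
lemma isUnitalModule_iff (hG : ∀ j, IsUnitalModule (SumRing D) (G.obj (T j)))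
    {Z : Type*} [AddCommGroup Z] [Module (Plus (TriRing T (SumRing D) G)) Z] :
    IsUnitalModule (TriRing T (SumRing D) G) Z ↔
      ∀ z : Z, ∃ s t, of (idem s t : TriRing T (SumRing D) G) • z = z := by
  classical
  rw [isUnitalModule_iff_exists
    (fun p : Finset I × Finset J => (idem p.1 p.2 : TriRing T (SumRing D) G))]
  · exact forall_congr' fun z => Prod.exists
  · intro r
    obtain ⟨s, hs⟩ := SumRing.exists_idem_mul r.x
    obtain ⟨t, ht⟩ := SumRing.exists_idem_mul r.y
    obtain ⟨s', hs'⟩ := SumRing.isUnitalModule_iff.mp (BiMod.isUnitalModule hG) r.m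
    refine ⟨⟨s ∪ s', t⟩, ?_⟩
    ext1
    · change SumRing.idem (s ∪ s') * r.x = r.x
      nth_rewrite 1 [← hs]
      rw [← mul_assoc, SumRing.idem_mul_idem Finset.subset_union_left, hs]
    · exact ht
    · change rightAct 0 r.y + of (SumRing.idem (s ∪ s')) • r.m = r.m
      nth_rewrite 1 [← hs']
      rw [← mul_smul, ← map_mul, SumRing.idem_mul_idem Finset.subset_union_right, hs',
        rightAct_zero_left, zero_add]
  · intro p q
    exact ⟨⟨p.1 ∪ q.1, p.2 ∪ q.2⟩,
      idem_mul_idem Finset.subset_union_left Finset.subset_union_left,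
      idem_mul_idem Finset.subset_union_right Finset.subset_union_right⟩

end TriRing

open TriRing

/-! ### Modules split by the diagonal subring: action, submodules, length -/

section Decomposition

variable {I : Type*} {D : I → Type*} [∀ i, Ring (D i)]
  {G : 𝒴 ⥤ ModuleCat.{v'} (Plus (SumRing D))} [G.Additive]
  {Z : Type*} [AddCommGroup Z] [Module (Plus (TriRing T (SumRing D) G)) Z]
  {X : Type*} [AddCommGroup X] [Module (Plus (SumRing D)) X]
  {Y : Type*} [AddCommGroup Y] [Module (Plus (EndRing T)) Y]

variable (T G) in
/-- A decomposition of a module over the triangular matrix ring which is compatible with the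
action of the diagonal subring. -/
structure IsDecomposition (e : Z ≃+ X × Y) : Prop where
  unital_left : IsUnitalModule (SumRing D) X
  unital_right : IsUnitalModule (EndRing T) Y
  diagonal : ∀ (x : SumRing D) (y : EndRing T) (z : Z),
    e (of (⟨x, y, 0⟩ : TriRing T (SumRing D) G) • z) = (of x • (e z).1, of y • (e z).2)

/-- The action of the bimodule in terms of a decomposition. -/
def IsDecomposition.bimod {e : Z ≃+ X × Y} (_ : IsDecomposition T G e)
    (m : BiMod T (SumRing D) G) (y : Y) : X :=
  (e (of (ofM m) • e.symm (0, y))).1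

variable {e : Z ≃+ X × Y} (he : IsDecomposition T G e)

namespace IsDecomposition

include he

lemma diagonal_symm (x : SumRing D) (y : EndRing T) (p : X) (q : Y) :
    of (⟨x, y, 0⟩ : TriRing T (SumRing D) G) • e.symm (p, q) = e.symm (of x • p, of y • q) := by
  rw [e.eq_symm_apply, he.diagonal, e.apply_symm_apply]

/-- The bimodule maps into the left summand: $m=e_s m$ for an idempotent $e_s$ of the left diagonal
ring, which kills the right summand. -/
lemma snd_smul (hG : ∀ j, IsUnitalModule (SumRing D) (G.obj (T j)))
    (r : TriRing T (SumRing D) G) (z : Z) : (e (of r • z)).2 = of r.y • (e z).2 := by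
  obtain ⟨s, hs⟩ := exists_idem_mul_ofM hG r.m
  nth_rewrite 1 [eq_add_ofM r]
  rw [← hs, map_add, map_mul, add_smul, mul_smul, map_add, he.diagonal, he.diagonal]
  simp

/-- The bimodule kills the left summand: $m=m e_t$ for an idempotent $e_t$ of the right diagonal
ring. Its action is thus entirely recorded by `bimod`. -/
lemma fst_smul (r : TriRing T (SumRing D) G) (z : Z) :
    (e (of r • z)).1 = of r.x • (e z).1 + he.bimod r.m (e z).2 := by
  obtain ⟨t, ht⟩ := exists_ofM_mul_idem r.m
  nth_rewrite 1 [eq_add_ofM r]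
  rw [map_add, add_smul, map_add, he.diagonal, Prod.fst_add, bimod]
  congr 2
  rw [← ht, map_mul, mul_smul, mul_smul, he.diagonal_symm]
  congr 2
  rw [← e.symm_apply_eq.mpr (he.diagonal _ _ _).symm]
  simp

lemma bimod_add_left (m m' : BiMod T (SumRing D) G) (y : Y) :
    he.bimod (m + m') y = he.bimod m y + he.bimod m' y := by
  rw [bimod, ofM_add, map_add, add_smul, map_add]; rfl

lemma bimod_add_right (m : BiMod T (SumRing D) G) (y y' : Y) :
    he.bimod m (y + y') = he.bimod m y + he.bimod m y' := by
  rw [bimod, show ((0 : X), y + y') = (0, y) + (0, y') by simp, map_add, smul_add, map_add]; rfl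

lemma bimod_zero_left (y : Y) : he.bimod 0 y = 0 := by
  simpa using he.bimod_add_left 0 0 y

lemma bimod_zero_right (m : BiMod T (SumRing D) G) : he.bimod m 0 = 0 := by
  simpa using he.bimod_add_right m 0 0

lemma bimod_sum_right {κ : Type*} (s : Finset κ) (m : BiMod T (SumRing D) G) (y : κ → Y) :
    he.bimod m (∑ k ∈ s, y k) = ∑ k ∈ s, he.bimod m (y k) :=
  map_sum (⟨⟨he.bimod m, he.bimod_zero_right m⟩, he.bimod_add_right m⟩ : Y →+ X) _ _

lemma bimod_smul (x : SumRing D) (m : BiMod T (SumRing D) G) (y : Y) :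
    he.bimod (of x • m) y = of x • he.bimod m y := by
  rw [bimod, ← mul_ofM x 0, map_mul, mul_smul, he.diagonal]; rfl

lemma bimod_rightAct (m : BiMod T (SumRing D) G) (b : EndRing T) (y : Y) :
    he.bimod (rightAct m b) y = he.bimod m (of b • y) := by
  rw [bimod, ← ofM_mul 0 b, map_mul, mul_smul, he.diagonal_symm, smul_zero]; rfl

lemma isUnitalModule (hG : ∀ j, IsUnitalModule (SumRing D) (G.obj (T j))) :
    IsUnitalModule (TriRing T (SumRing D) G) Z := by
  refine (TriRing.isUnitalModule_iff hG).mpr fun z => ?_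
  obtain ⟨s, hs⟩ := SumRing.isUnitalModule_iff.mp he.unital_left (e z).1
  obtain ⟨t, ht⟩ := SumRing.isUnitalModule_iff.mp he.unital_right (e z).2
  refine ⟨s, t, e.injective ?_⟩
  rw [TriRing.idem, he.diagonal, hs, ht]

/-- The component is obtained from $z$ by acting with a diagonal idempotent, so it stays in the
submodule. Hence every submodule is the sum of its two traces. -/
lemma symm_fst_mem (U : Submodule (Plus (TriRing T (SumRing D) G)) Z) {z : Z} (hz : z ∈ U) :
    e.symm ((e z).1, 0) ∈ U := by
  obtain ⟨s, hs⟩ := SumRing.isUnitalModule_iff.mp he.unital_left (e z).1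
  rw [← hs, ← zero_smul (Plus (EndRing T)) (e z).2, ← map_zero (of (A := EndRing T)),
    ← he.diagonal_symm, Prod.mk.eta, e.symm_apply_apply]
  exact U.smul_mem _ hz

lemma symm_snd_mem (U : Submodule (Plus (TriRing T (SumRing D) G)) Z) {z : Z} (hz : z ∈ U) :
    e.symm (0, (e z).2) ∈ U := by
  obtain ⟨t, ht⟩ := SumRing.isUnitalModule_iff.mp he.unital_right (e z).2
  rw [← ht, ← zero_smul (Plus (SumRing D)) (e z).1, ← map_zero (of (A := SumRing D)),
    ← he.diagonal_symm, Prod.mk.eta, e.symm_apply_apply]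
  exact U.smul_mem _ hz

/-- The trace of a submodule on the left summand. -/
def left (U : Submodule (Plus (TriRing T (SumRing D) G)) Z) : Submodule (Plus (SumRing D)) X :=
  Plus.submodule (U.toAddSubgroup.comap (e.symm.toAddMonoidHom.comp (AddMonoidHom.inl X Y)))
    fun x p (hp : e.symm (p, 0) ∈ U) => by
      change e.symm (of x • p, 0) ∈ U
      rw [← smul_zero (of (0 : EndRing T)), ← he.diagonal_symm]
      exact U.smul_mem _ hp

/-- The trace of a submodule on the right summand. -/
def right (U : Submodule (Plus (TriRing T (SumRing D) G)) Z) : Submodule (Plus (EndRing T)) Y :=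
  Plus.submodule (U.toAddSubgroup.comap (e.symm.toAddMonoidHom.comp (AddMonoidHom.inr X Y)))
    fun y p (hp : e.symm (0, p) ∈ U) => by
      change e.symm (0, of y • p) ∈ U
      rw [← smul_zero (of (0 : SumRing D)), ← he.diagonal_symm]
      exact U.smul_mem _ hp

lemma le_of_left_le_of_right_le {U V : Submodule (Plus (TriRing T (SumRing D) G)) Z}
    (h₁ : he.left U ≤ he.left V) (h₂ : he.right U ≤ he.right V) : U ≤ V := fun z hz => by
  have := V.add_mem (h₁ (he.symm_fst_mem U hz)) (h₂ (he.symm_snd_mem U hz))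
  change e.symm ((e z).1, 0) + e.symm (0, (e z).2) ∈ V at this
  rwa [← map_add, Prod.mk_add_mk, add_zero, zero_add, Prod.mk.eta, e.symm_apply_apply] at this

/-- Since a submodule is determined by its traces, chain conditions pass from the two summands to
$Z$. -/
lemma strictMono : StrictMono fun U : Submodule (Plus (TriRing T (SumRing D) G)) Z =>
    (he.left U, he.right U) := by
  refine Monotone.strictMono_of_injective (fun U V h => ⟨fun x hx => h hx, fun x hx => h hx⟩)
    fun U V h => le_antisymm ?_ ?_
  · exact he.le_of_left_le_of_right_le (congrArg Prod.fst h).le (congrArg Prod.snd h).le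
  · exact he.le_of_left_le_of_right_le (congrArg Prod.fst h).ge (congrArg Prod.snd h).ge

lemma isFiniteLength (hX : IsFiniteLength (Plus (SumRing D)) X)
    (hY : IsFiniteLength (Plus (EndRing T)) Y) :
    IsFiniteLength (Plus (TriRing T (SumRing D) G)) Z := by
  obtain ⟨_, _⟩ := isFiniteLength_iff_isNoetherian_isArtinian.mp hX
  obtain ⟨_, _⟩ := isFiniteLength_iff_isNoetherian_isArtinian.mp hY
  exact isFiniteLength_iff_isNoetherian_isArtinian.mpr
    ⟨isNoetherian_iff'.mpr he.strictMono.wellFoundedGT, he.strictMono.wellFoundedLT⟩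

lemma isFiniteLength_left (hG : ∀ j, IsUnitalModule (SumRing D) (G.obj (T j)))
    (hZ : IsFiniteLength (Plus (TriRing T (SumRing D) G)) Z) :
    IsFiniteLength (Plus (SumRing D)) X := by
  obtain ⟨_, _⟩ := isFiniteLength_iff_isNoetherian_isArtinian.mp hZ
  -- The subgroup $U\oplus 0$ is stable because the bimodule kills the left summand.
  let Ψ (U : Submodule (Plus (SumRing D)) X) : Submodule (Plus (TriRing T (SumRing D) G)) Z :=
    Plus.submodule ((U.toAddSubgroup.prod ⊥).comap e.toAddMonoidHom)
      fun r z (hz : (e z).1 ∈ U ∧ (e z).2 = 0) => by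
        change (e (of r • z)).1 ∈ U ∧ (e (of r • z)).2 = 0
        rw [he.fst_smul, he.snd_smul hG, hz.2, smul_zero, he.bimod_zero_right, add_zero]
        exact ⟨U.smul_mem _ hz.1, rfl⟩
  have hΨ : StrictMono Ψ := by
    refine Monotone.strictMono_of_injective (fun U V h z hz => ⟨h hz.1, hz.2⟩) fun U V h => ?_
    ext x
    have hx (U : Submodule (Plus (SumRing D)) X) : e.symm (x, 0) ∈ Ψ U ↔ x ∈ U := by
      change (e _).1 ∈ U ∧ (e _).2 = 0 ↔ _
      simp
    rw [← hx, h, hx]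
  exact isFiniteLength_iff_isNoetherian_isArtinian.mpr
    ⟨isNoetherian_iff'.mpr hΨ.wellFoundedGT, hΨ.wellFoundedLT⟩

lemma isFiniteLength_right (hG : ∀ j, IsUnitalModule (SumRing D) (G.obj (T j)))
    (hZ : IsFiniteLength (Plus (TriRing T (SumRing D) G)) Z) :
    IsFiniteLength (Plus (EndRing T)) Y := by
  obtain ⟨_, _⟩ := isFiniteLength_iff_isNoetherian_isArtinian.mp hZ
  -- The subgroup $X\oplus U$ is stable because the bimodule maps everything into $X$; the left
  -- summand must be included in full.
  let Ψ (U : Submodule (Plus (EndRing T)) Y) : Submodule (Plus (TriRing T (SumRing D) G)) Z :=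
    Plus.submodule (U.toAddSubgroup.comap ((AddMonoidHom.snd X Y).comp e.toAddMonoidHom))
      fun r z (hz : (e z).2 ∈ U) => by
        change (e (of r • z)).2 ∈ U
        rw [he.snd_smul hG]
        exact U.smul_mem _ hz
  have hΨ : StrictMono Ψ := by
    refine Monotone.strictMono_of_injective (fun U V h z hz => h hz) fun U V h => ?_
    ext y
    have hy (U : Submodule (Plus (EndRing T)) Y) : e.symm (0, y) ∈ Ψ U ↔ y ∈ U := by
      change (e _).2 ∈ U ↔ _
      simp
    rw [← hy, h, hy]
  exact isFiniteLength_iff_isNoetherian_isArtinian.mpr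
    ⟨isNoetherian_iff'.mpr hΨ.wellFoundedGT, hΨ.wellFoundedLT⟩

end IsDecomposition

end Decomposition

open Plus TriRing

/-! ### Splitting a unital module by diagonal idempotents -/

section UnitalPart

variable {I : Type*} {D : I → Type*} [∀ i, Ring (D i)] {B : Type*} [NonUnitalRing B]
  (ψ : SumRing D →ₙ+* B) (Z : Type*) [AddCommGroup Z] [Module (Plus B) Z]

variable {Z} in
lemma smul_eq_of_subset {s t : Finset I} (h : s ⊆ t) {z : Z}
    (hz : of (ψ (SumRing.idem s)) • z = z) : of (ψ (SumRing.idem t)) • z = z := by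
  nth_rewrite 1 [← hz]
  rw [← mul_smul, ← map_mul, ← map_mul, SumRing.idem_mul_idem h, hz]

/-- The largest subgroup of a `B`-module which is a unital module over `⨁ D i`. -/
def unitalPart : AddSubgroup Z where
  carrier := {z | ∃ s : Finset I, of (ψ (SumRing.idem s)) • z = z}
  zero_mem' := ⟨∅, smul_zero _⟩
  add_mem' {z z'} := by
    classical
    rintro ⟨s, hs⟩ ⟨t, ht⟩
    exact ⟨s ∪ t, by rw [smul_add, smul_eq_of_subset ψ Finset.subset_union_left hs,
      smul_eq_of_subset ψ Finset.subset_union_right ht]⟩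
  neg_mem' {z} := by
    rintro ⟨s, hs⟩
    exact ⟨s, by rw [smul_neg, hs]⟩

variable {Z} in
lemma smul_mem_unitalPart (a : SumRing D) (z : Z) : of (ψ a) • z ∈ unitalPart ψ Z := by
  obtain ⟨s, hs⟩ := SumRing.exists_idem_mul a
  exact ⟨s, by rw [← mul_smul, ← map_mul, ← map_mul, hs]⟩

/-- The action of `⨁ D i` on the unital part of a module. -/
def unitalPartAction : SumRing D →ₙ+* AddMonoid.End (unitalPart ψ Z) where
  toFun a :=
    { toFun := fun z => ⟨of (ψ a) • (z : Z), smul_mem_unitalPart ψ a (z : Z)⟩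
      map_zero' := Subtype.ext (smul_zero (A := Z) _)
      map_add' := fun z z' => Subtype.ext (smul_add _ (z : Z) (z' : Z)) }
  map_zero' := AddMonoidHom.ext fun z => Subtype.ext <| by
    change of (ψ 0) • (z : Z) = 0
    rw [map_zero, map_zero, zero_smul]
  map_add' a b := AddMonoidHom.ext fun z => Subtype.ext <| by
    change of (ψ (a + b)) • (z : Z) = of (ψ a) • (z : Z) + of (ψ b) • (z : Z)
    rw [map_add, map_add, add_smul]
  map_mul' a b := AddMonoidHom.ext fun z => Subtype.ext <| by
    change of (ψ (a * b)) • (z : Z) = of (ψ a) • of (ψ b) • (z : Z)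
    rw [map_mul, map_mul, mul_smul]

instance : Module (Plus (SumRing D)) (unitalPart ψ Z) := moduleOfAction (unitalPartAction ψ Z)

variable {Z} in
lemma coe_of_smul_unitalPart (a : SumRing D) (z : unitalPart ψ Z) :
    ((of a • z : unitalPart ψ Z) : Z) = of (ψ a) • (z : Z) :=
  congrArg (Subtype.val : unitalPart ψ Z → Z)
    (of_smul_moduleOfAction (unitalPartAction ψ Z) a z)

lemma isUnitalModule_unitalPart : IsUnitalModule (SumRing D) (unitalPart ψ Z) :=
  SumRing.isUnitalModule_iff.mpr fun z => by
    obtain ⟨s, hs⟩ := z.2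
    exact ⟨s, Subtype.ext ((coe_of_smul_unitalPart ψ _ z).trans hs)⟩

end UnitalPart

variable {𝒴 : Type u} [Category.{v} 𝒴] [Preadditive 𝒴] {J : Type w} {T : J → 𝒴}

section

variable {I : Type*} {D : I → Type*} [∀ i, Ring (D i)]
  {G : 𝒴 ⥤ ModuleCat.{v'} (Plus (SumRing D))} [G.Additive]

variable (T G) in
/-- The inclusion of the left diagonal subring. -/
def inclLeft : SumRing D →ₙ+* TriRing T (SumRing D) G where
  toFun x := ⟨x, 0, 0⟩
  map_zero' := rfl
  map_add' x x' := by ext1 <;> simp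
  map_mul' x x' := by ext1 <;> simp

variable (T G) in
/-- The inclusion of the right diagonal subring. -/
def inclRight : EndRing T →ₙ+* TriRing T (SumRing D) G where
  toFun y := ⟨0, y, 0⟩
  map_zero' := rfl
  map_add' y y' := by ext1 <;> simp
  map_mul' y y' := by ext1 <;> simp

lemma inclLeft_apply (x : SumRing D) : inclLeft T G x = ⟨x, 0, 0⟩ := rfl

lemma inclRight_apply (y : EndRing T) : inclRight T G y = ⟨0, y, 0⟩ := rfl

lemma diagonal_mul_inclLeft (x : SumRing D) (y : EndRing T) (x' : SumRing D) :
    ⟨x, y, 0⟩ * inclLeft T G x' = inclLeft T G x * inclLeft T G x' := by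
  ext1 <;> simp [inclLeft_apply]

lemma diagonal_mul_inclRight (x : SumRing D) (y y' : EndRing T) :
    ⟨x, y, 0⟩ * inclRight T G y' = inclRight T G y * inclRight T G y' := by
  ext1 <;> simp [inclRight_apply]

section

variable {Z : Type*} [AddCommGroup Z] [Module (Plus (TriRing T (SumRing D) G)) Z]

lemma diagonal_smul_unitalPart_left (x : SumRing D) (y : EndRing T)
    (p : unitalPart (inclLeft T G) Z) :
    of (⟨x, y, 0⟩ : TriRing T (SumRing D) G) • (p : Z) = of (inclLeft T G x) • (p : Z) := by
  obtain ⟨s, hs⟩ := p.2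
  rw [← hs, ← mul_smul, ← mul_smul, ← map_mul, ← map_mul, diagonal_mul_inclLeft]

lemma diagonal_smul_unitalPart_right (x : SumRing D) (y : EndRing T)
    (p : unitalPart (inclRight T G) Z) :
    of (⟨x, y, 0⟩ : TriRing T (SumRing D) G) • (p : Z) = of (inclRight T G y) • (p : Z) := by
  obtain ⟨s, hs⟩ := p.2
  rw [← hs, ← mul_smul, ← mul_smul, ← map_mul, ← map_mul, diagonal_mul_inclRight]

/-- Every unital module over the triangular matrix ring has a decomposition. -/
theorem exists_isDecomposition (hG : ∀ j, IsUnitalModule (SumRing D) (G.obj (T j)))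
    (hZ : IsUnitalModule (TriRing T (SumRing D) G) Z) :
    ∃ e : Z ≃+ unitalPart (inclLeft T G) Z × unitalPart (inclRight T G) Z,
      IsDecomposition T G e := by
  let f : unitalPart (inclLeft T G) Z × unitalPart (inclRight T G) Z →+ Z :=
    AddMonoidHom.coprod (AddSubgroup.subtype _) (AddSubgroup.subtype _)
  have hf : Function.Bijective f := by
    constructor
    · rw [injective_iff_map_eq_zero]
      rintro ⟨p, q⟩ (h : (p : Z) + q = 0)
      -- An idempotent of the left diagonal ring fixes $p=-q$ but kills $q$, by orthogonality of the
      -- two diagonal rings.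
      have hp : (p : Z) = 0 := by
        obtain ⟨s, hs⟩ := p.2
        rw [← hs, eq_neg_of_add_eq_zero_left h, smul_neg]
        have := diagonal_smul_unitalPart_right (SumRing.idem s) 0 q
        rw [map_zero, map_zero, zero_smul] at this
        rw [← neg_zero, ← this]
        rfl
      rw [hp, zero_add] at h
      exact Prod.ext (Subtype.ext hp) (Subtype.ext h)
    · intro z
      obtain ⟨s, t, hst⟩ := (TriRing.isUnitalModule_iff hG).mp hZ z
      refine ⟨(⟨_, smul_mem_unitalPart (inclLeft T G) (SumRing.idem s) z⟩,
        ⟨_, smul_mem_unitalPart (inclRight T G) (SumRing.idem t) z⟩), ?_⟩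
      change of (inclLeft T G (SumRing.idem s)) • z +
        of (inclRight T G (SumRing.idem t)) • z = z
      rw [← add_smul, ← map_add]
      nth_rewrite 2 [← hst]
      congr 2
      ext1 <;> simp [inclLeft_apply, inclRight_apply, TriRing.idem]
  refine ⟨(AddEquiv.ofBijective f hf).symm, isUnitalModule_unitalPart _ _,
    isUnitalModule_unitalPart _ _, fun x y z => ?_⟩
  obtain ⟨⟨p, q⟩, rfl⟩ := hf.2 z
  have h (a) : (AddEquiv.ofBijective f hf).symm (f a) = a :=
    (AddEquiv.ofBijective f hf).symm_apply_apply a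
  rw [h, ← h (of x • _, of y • _)]
  congr 1
  change of _ • ((p : Z) + q) = ((of x • p : unitalPart (inclLeft T G) Z) : Z) +
    (of y • q : unitalPart (inclRight T G) Z)
  rw [smul_add, diagonal_smul_unitalPart_left, diagonal_smul_unitalPart_right,
    coe_of_smul_unitalPart, coe_of_smul_unitalPart]

end

/-! ### Linear maps between modules of triples -/

namespace TriMod

variable {Y : 𝒴} {X : Type*} [AddCommGroup X] [Module (Plus (SumRing D)) X]
  {η : G.obj Y →ₗ[Plus (SumRing D)] X}

lemma isDecomposition (hX : IsUnitalModule (SumRing D) X) :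
    IsDecomposition T G (equiv T η) where
  unital_left := hX
  unital_right := HomSum.isUnitalModule Y
  diagonal x y z := equiv_of_diagonal_smul η x y z

variable {Y' : 𝒴} {X' : Type*} [AddCommGroup X'] [Module (Plus (SumRing D)) X']
  {η' : G.obj Y' →ₗ[Plus (SumRing D)] X'}

/-- An element of the left summand is fixed by an idempotent of the left diagonal ring, and so is
its image, whose right component that idempotent kills. -/
lemma equiv_inl (hX : IsUnitalModule (SumRing D) X)
    (φ : TriMod T η →ₗ[Plus (TriRing T (SumRing D) G)] TriMod T η') (x : X) :
    (equiv T η' (φ ((equiv T η).symm (x, 0)))).2 = 0 := by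
  obtain ⟨s, hs⟩ := SumRing.isUnitalModule_iff.mp hX x
  have := (isDecomposition (T := T) (η := η) hX).diagonal_symm (SumRing.idem s) 0 x 0
  rw [hs, smul_zero] at this
  rw [← this, map_smul, equiv_of_diagonal_smul, map_zero, zero_smul]

lemma equiv_inr (φ : TriMod T η →ₗ[Plus (TriRing T (SumRing D) G)] TriMod T η')
    (n : HomSum T Y) : (equiv T η' (φ ((equiv T η).symm (0, n)))).1 = 0 := by
  obtain ⟨t, ht⟩ := SumRing.isUnitalModule_iff.mp (HomSum.isUnitalModule Y) n
  have : of (⟨0, SumRing.idem t, 0⟩ : TriRing T (SumRing D) G) • (equiv T η).symm (0, n) =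
      (equiv T η).symm (0, n) := by
    rw [AddEquiv.eq_symm_apply, equiv_of_diagonal_smul, AddEquiv.apply_symm_apply, ht, smul_zero]
  rw [← this, map_smul, equiv_of_diagonal_smul, map_zero, zero_smul]

lemma equiv_pair (m : BiMod T (SumRing D) G) (n : HomSum T Y) :
    of (ofM m) • (equiv T η).symm (0, n) = (equiv T η).symm (pair η m n, 0) := by
  rw [AddEquiv.eq_symm_apply, equiv_of_smul, AddEquiv.apply_symm_apply]
  simp [ofM]

/-- Two linear maps out of `G(Y)` agree if they agree on the images of the `G(T j)`. -/
lemma hom_ext_of_isFiniteSummand (hY : IsFiniteSummand T Y)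
    {f g : G.obj Y →ₗ[Plus (SumRing D)] X}
    (h : ∀ (j : J) (a : T j ⟶ Y) (x : G.obj (T j)), f ((G.map a).hom x) = g ((G.map a).hom x)) :
    f = g := by
  obtain ⟨κ, _, i, a, b, hab⟩ := hY
  ext x
  have hx : x = ∑ k, (G.map (a k)).hom ((G.map (b k)).hom x) := by
    have := congrArg (fun f => (G.map f).hom x) hab
    simp only [G.map_sum, G.map_id, ModuleCat.hom_sum, LinearMap.sum_apply, G.map_comp] at this
    exact this.symm
  rw [hx, map_sum, map_sum]
  exact Finset.sum_congr rfl fun k _ => h _ _ _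

/-- Compatibility with diagonal idempotents makes `φ` block diagonal. Its right block comes from a
morphism $g$, and linearity over the bimodule is the commutativity of the square of triples. -/
theorem exists_map_eq [HasKernels 𝒴] (hT : IsSimpleRepresentatives T) (hY : IsFiniteSummand T Y)
    (hX : IsUnitalModule (SumRing D) X)
    (φ : TriMod T η →ₗ[Plus (TriRing T (SumRing D) G)] TriMod T η') :
    ∃ (f : X →ₗ[Plus (SumRing D)] X') (g : Y ⟶ Y') (h : f ∘ₗ η = η' ∘ₗ (G.map g).hom),
      map f g h = φ := by
  let f : X →ₗ[Plus (SumRing D)] X' := Plus.linearMap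
    ((AddMonoidHom.fst _ _).comp <| (equiv T η').toAddMonoidHom.comp <|
      φ.toAddMonoidHom.comp <| (equiv T η).symm.toAddMonoidHom.comp <| AddMonoidHom.inl _ _)
    fun a x => by
      change (equiv T η' (φ ((equiv T η).symm (of a • x, 0)))).1 =
        of a • (equiv T η' (φ ((equiv T η).symm (x, 0)))).1
      have := (isDecomposition (T := T) (η := η) hX).diagonal_symm a 0 x 0
      rw [smul_zero] at this
      rw [← this, map_smul, equiv_of_diagonal_smul]
  let φY : HomSum T Y →ₗ[Plus (EndRing T)] HomSum T Y' := Plus.linearMap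
    ((AddMonoidHom.snd _ _).comp <| (equiv T η').toAddMonoidHom.comp <|
      φ.toAddMonoidHom.comp <| (equiv T η).symm.toAddMonoidHom.comp <| AddMonoidHom.inr _ _)
    fun a n => by
      change (equiv T η' (φ ((equiv T η).symm (0, of a • n)))).2 =
        of a • (equiv T η' (φ ((equiv T η).symm (0, n)))).2
      have := (isDecomposition (T := T) (η := η) hX).diagonal_symm 0 a 0 n
      rw [smul_zero] at this
      rw [← this, map_smul, equiv_of_diagonal_smul]
  obtain ⟨g, hg⟩ := hT.exists_map_eq hY φY
  have hφY (n) : (equiv T η' (φ ((equiv T η).symm (0, n)))).2 = HomSum.map g n := by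
    rw [hg]; rfl
  refine ⟨f, g, hom_ext_of_isFiniteSummand hY fun j a x => ?_, ?_⟩
  -- The element $x$ in the summand $G(T_j)$ of $M$, paired with $a:T_j\to Y$, gives
  -- $\eta(G(a)(x))$. Such elements $G(a)(x)$ span $G(Y)$.
  · have h₁ := congrArg (fun p => (equiv T η' (φ p)).1)
      (equiv_pair (η := η) (biSingle j x) (HomSum.single j a))
    simp only [map_smul, equiv_of_smul, equiv_inr, smul_zero, zero_add, hφY, ofM] at h₁
    rw [pair_biSingle, pair_biSingle, HomSum.coeff_single_same, HomSum.map_apply,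
      HomSum.mapFun_single, HomSum.coeff_single_same, G.map_comp] at h₁
    exact h₁.symm
  · refine LinearMap.ext fun p => (equiv T η').injective ?_
    rw [equiv_map]
    have hp : p = (equiv T η).symm ((equiv T η p).1, 0) +
        (equiv T η).symm (0, (equiv T η p).2) := by
      rw [← map_add, Prod.mk_add_mk, add_zero, zero_add, Prod.mk.eta, AddEquiv.symm_apply_apply]
    nth_rewrite 3 [hp]
    rw [map_add, map_add]
    refine Prod.ext ?_ ?_
    · rw [Prod.fst_add, equiv_inr, add_zero]; rfl
    · rw [Prod.snd_add, equiv_inl hX, zero_add, hφY]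

lemma map_injective (hY : IsFiniteSummand T Y) {f f' : X →ₗ[Plus (SumRing D)] X'} {g g' : Y ⟶ Y'}
    {h : f ∘ₗ η = η' ∘ₗ (G.map g).hom} {h' : f' ∘ₗ η = η' ∘ₗ (G.map g').hom}
    (H : (map f g h : TriMod T η →ₗ[_] TriMod T η') = map f' g' h') : f = f' ∧ g = g' := by
  have H' (p : X × HomSum T Y) : (f p.1, HomSum.map g p.2) = (f' p.1, HomSum.map g' p.2) :=
    congrArg (fun φ => equiv T η' (φ ((equiv T η).symm p))) H
  exact ⟨LinearMap.ext fun x => congrArg Prod.fst (H' (x, 0)),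
    IsSimpleRepresentatives.map_injective hY
      (LinearMap.ext fun n => congrArg Prod.snd (H' (0, n)))⟩

end TriMod

/-! ### Recovering the triple from the module -/

section EssSurj

variable {Z : Type*} [AddCommGroup Z] [Module (Plus (TriRing T (SumRing D) G)) Z]
  {X : Type*} [AddCommGroup X] [Module (Plus (SumRing D)) X] {Y : 𝒴}
  {e : Z ≃+ X × HomSum T Y}

namespace IsDecomposition

/-- The balancing relation extended to morphisms between different $T_j$: within one summand it is
`bimod_rightAct`, and otherwise $f=0$ by Schur's lemma. -/
lemma bimod_comp [HasKernels 𝒴] (he : IsDecomposition T G e) (hT : IsSimpleRepresentatives T)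
    {j l : J} (f : T j ⟶ T l)
    (a : T l ⟶ Y) (x : G.obj (T j)) :
    he.bimod (biSingle j x) (HomSum.single j (f ≫ a)) =
      he.bimod (biSingle l ((G.map f).hom x)) (HomSum.single l a) := by
  by_cases h : j = l
  · subst h
    have := he.bimod_rightAct (biSingle j x)
      (SumRing.single j (MulOpposite.op (show End (T j) from f))) (HomSum.single j a)
    rw [rightAct_biSingle, HomSum.of_smul, HomSum.act_single] at this
    simp only [SumRing.coeff_single_same, MulOpposite.unop_op] at this
    exact this.symm
  · rw [hT.eq_zero h f]
    simp [he.bimod_zero_left, he.bimod_zero_right]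

lemma bimod_biSingle (he : IsDecomposition T G e) (j : J) (x : G.obj (T j)) (n : HomSum T Y) :
    he.bimod (biSingle j x) n = he.bimod (biSingle j x) (HomSum.single j (n.coeff j)) := by
  have := he.bimod_rightAct (biSingle j x) (SumRing.single j (1 : (End (T j))ᵐᵒᵖ)) n
  rw [rightAct_biSingle, HomSum.of_smul, HomSum.act_ringSingle] at this
  simpa [End.one_def] using this

/-- A decomposable module comes from a triple. -/
theorem exists_triMod_equiv [HasKernels 𝒴] (he : IsDecomposition T G e)
    (hT : IsSimpleRepresentatives T) (hY : IsFiniteSummand T Y)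
    (hG : ∀ j, IsUnitalModule (SumRing D) (G.obj (T j))) :
    ∃ η : G.obj Y →ₗ[Plus (SumRing D)] X,
      Nonempty (TriMod T η ≃ₗ[Plus (TriRing T (SumRing D) G)] Z) := by
  obtain ⟨κ, _, i, a, b, hab⟩ := hY
  -- As $x=\sum_k G(a_k)G(b_k)(x)$, the value of $\eta$ at $x$ must be the sum of the pairings of
  -- $G(b_k)(x)$ with $a_k$.
  let η : G.obj Y →ₗ[Plus (SumRing D)] X := Plus.linearMap
    { toFun := fun x => ∑ k, he.bimod (biSingle (i k) ((G.map (b k)).hom x))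
        (HomSum.single (i k) (a k))
      map_zero' := by simp [he.bimod_zero_left]
      map_add' := fun x y => by
        simp only [map_add, biSingle_add, he.bimod_add_left, Finset.sum_add_distrib] }
    fun r x => by
      change ∑ k, _ = of r • ∑ k, _
      rw [Finset.smul_sum]
      refine Finset.sum_congr rfl fun k _ => ?_
      rw [← he.bimod_smul, smul_biSingle, map_smul]
  have hη (m : BiMod T (SumRing D) G) (n : HomSum T Y) : he.bimod m n = pair η m n := by
    induction m using BiMod.induction with
    | zero => rw [pair_zero_left, he.bimod_zero_left]
    | add m m' h h' => rw [pair_add_left, he.bimod_add_left, h, h']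
    | single j x =>
      rw [pair_biSingle, he.bimod_biSingle, ← Category.comp_id (n.coeff j), ← hab,
        Preadditive.comp_sum, HomSum.single_sum, he.bimod_sum_right]
      change _ = ∑ k, _
      refine Finset.sum_congr rfl fun k _ => ?_
      -- Each component of $n$ is rewritten through the $b_k$ and $a_k$; balancing moves the part
      -- ending in $b_k$ to the bimodule side, which gives the formula defining $\eta$.
      rw [← Category.assoc, he.bimod_comp hT, G.map_comp, ← Preadditive.comp_sum, hab,
        Category.comp_id]
      rfl
  refine ⟨η, ⟨(Plus.linearEquiv (e.trans (TriMod.equiv T η).symm) fun r z => ?_).symm⟩⟩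
  apply (TriMod.equiv T η).injective
  rw [TriMod.equiv_of_smul]
  change e (of r • z) = (of r.x • (e z).1 + pair η r.m (e z).2, of r.y • (e z).2)
  exact Prod.ext (by rw [he.fst_smul, hη]) (he.snd_smul hG r z)

end IsDecomposition

end EssSurj

end

open Plus TriRing

/-! ### The functor from triples to modules and its image -/

section Functor

variable {𝒴 : Type u} [Category.{v} 𝒴] {J : Type w} (T : J → 𝒴)
  {I : Type*} {D : I → Type*} [∀ i, Ring (D i)] {𝒳t : Type u'} [Category.{v'} 𝒳t]
  (F : 𝒴 ⥤ 𝒳t) (K : 𝒳t ⥤ ModuleCat.{max w v} (Plus (SumRing D)))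

variable {T F K} in
lemma triFunctor_w {Z Z' : Comma F (𝟭 𝒳t)} (f : Z ⟶ Z') :
    (K.map f.right).hom ∘ₗ (K.map Z.hom).hom =
      (K.map Z'.hom).hom ∘ₗ ((F ⋙ K).map f.left).hom := by
  have h : K.map Z.hom ≫ K.map f.right = K.map (F.map f.left) ≫ K.map Z'.hom :=
    (K.map_comp _ _).symm.trans ((congrArg K.map f.w.symm).trans (K.map_comp _ _))
  exact congrArg ModuleCat.Hom.hom h

variable [Preadditive 𝒴] [(F ⋙ K).Additive]

/-- The functor which attaches to a triple a module over the triangular matrix ring. -/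
def triFunctor :
    Comma F (𝟭 𝒳t) ⥤ ModuleCat.{max w v} (Plus (TriRing T (SumRing D) (F ⋙ K))) where
  obj Z := ModuleCat.of _
    (TriMod T (G := F ⋙ K) (X := K.obj Z.right) (Y := Z.left) (K.map Z.hom).hom)
  map f := ModuleCat.ofHom (TriMod.map (K.map f.right).hom f.left (triFunctor_w f))
  map_id _ := by
    refine ModuleCat.hom_ext (LinearMap.ext fun p => ?_)
    exact TriMod.ext' (LinearMap.congr_fun (f := (K.map (𝟙 _)).hom)
      (congrArg ModuleCat.Hom.hom (K.map_id _)) _)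
      (HomSum.ext fun j => (HomSum.coeff_mapFun _ _ j).trans (Category.comp_id _))
  map_comp {_ _ Z} f g := by
    refine ModuleCat.hom_ext (LinearMap.ext fun p => ?_)
    refine TriMod.ext' (G := F ⋙ K) (η := (K.map Z.hom).hom)
      (LinearMap.congr_fun (f := (K.map (f.right ≫ g.right)).hom)
        (congrArg ModuleCat.Hom.hom (K.map_comp f.right g.right)) _) (HomSum.ext fun j => ?_)
    change (HomSum.mapFun (f.left ≫ g.left) _).coeff j =
      (HomSum.mapFun g.left (HomSum.mapFun f.left _)).coeff j
    rw [HomSum.coeff_mapFun, HomSum.coeff_mapFun, HomSum.coeff_mapFun, Category.assoc]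

variable {T F K}

lemma triFunctor_faithful [K.Faithful] (hfin : ∀ Y : 𝒴, IsFiniteSummand T Y) :
    (triFunctor T F K).Faithful where
  map_injective {Z Z'} f g h := by
    obtain ⟨h₁, h₂⟩ := TriMod.map_injective (hfin Z.left) (h := triFunctor_w f)
      (h' := triFunctor_w g) (congrArg ModuleCat.Hom.hom h)
    exact CommaMorphism.ext h₂ (K.map_injective (ModuleCat.hom_ext h₁))

lemma triFunctor_full [HasKernels 𝒴] [K.Full] [K.Faithful] (hT : IsSimpleRepresentatives T)
    (hfin : ∀ Y : 𝒴, IsFiniteSummand T Y) (hK : ∀ X, IsUnitalModule (SumRing D) (K.obj X)) :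
    (triFunctor T F K).Full where
  map_surjective {Z Z'} φ := by
    obtain ⟨f, g, h, hφ⟩ := TriMod.exists_map_eq hT (hfin Z.left) (hK Z.right) φ.hom
    obtain ⟨f, rfl⟩ : ∃ f' : Z.right ⟶ Z'.right, (K.map f').hom = f :=
      ⟨K.preimage (ModuleCat.ofHom f), by rw [K.map_preimage]; rfl⟩
    -- Fullness of $K$ has lifted the left block to a morphism; faithfulness now lifts the
    -- commutativity of the square.
    refine ⟨⟨g, f, K.map_injective (ModuleCat.hom_ext ?_)⟩, ModuleCat.hom_ext hφ⟩
    rw [K.map_comp]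
    exact h.symm.trans (congrArg ModuleCat.Hom.hom (K.map_comp _ _).symm)

lemma triFunctor_obj_isDecomposition (hK : ∀ X, IsUnitalModule (SumRing D) (K.obj X))
    (Z : Comma F (𝟭 𝒳t)) :
    IsDecomposition T (F ⋙ K) (X := K.obj Z.right) (Y := HomSum T Z.left)
      (Z := (triFunctor T F K).obj Z)
      (TriMod.equiv T (G := F ⋙ K) (X := K.obj Z.right) (Y := Z.left) (K.map Z.hom).hom) :=
  TriMod.isDecomposition (hK _)

lemma locallyFiniteModules_triFunctor [HasKernels 𝒴] (hT : IsSimpleRepresentatives T)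
    (hfin : ∀ Y : 𝒴, IsFiniteSummand T Y) (hK : ∀ X, semisimpleModules (SumRing D) (K.obj X))
    (Z : Comma F (𝟭 𝒳t)) :
    locallyFiniteModules T (SumRing D) (F ⋙ K) ((triFunctor T F K).obj Z) :=
  ⟨K.obj Z.right, ModuleCat.of _ (HomSum T Z.left), _, hK _,
    ⟨HomSum.isUnitalModule _, hT.isFiniteLength_homSum (hfin _)⟩,
    (triFunctor_obj_isDecomposition (fun X => (hK X).1) Z).diagonal⟩

end Functor

section EssSurj

variable {𝒴 : Type u} [Category.{v} 𝒴] [Abelian 𝒴] {J : Type w} {T : J → 𝒴}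
  {I : Type*} {D : I → Type*} [∀ i, Ring (D i)] {𝒳t : Type u'} [Category.{v'} 𝒳t]
  {F : 𝒴 ⥤ 𝒳t} {K : 𝒳t ⥤ ModuleCat.{max w v} (Plus (SumRing D))} [(F ⋙ K).Additive]

/-- A decomposable module is in the image of the functor. -/
lemma exists_triFunctor_obj_iso [K.Full]
    (hT : IsSimpleRepresentatives T)
    (hfin : ∀ Y : 𝒴, IsFiniteSummand T Y) (hK : ∀ X, IsUnitalModule (SumRing D) (K.obj X))
    {Z : ModuleCat.{max w v} (Plus (TriRing T (SumRing D) (F ⋙ K)))}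
    {X Y : Type*} [AddCommGroup X] [Module (Plus (SumRing D)) X] [AddCommGroup Y]
    [Module (Plus (EndRing T)) Y] {e : Z ≃+ X × Y} (he : IsDecomposition T (F ⋙ K) e)
    (hY : IsFiniteLength (Plus (EndRing T)) Y) {X₀ : 𝒳t}
    (φ : X ≃ₗ[Plus (SumRing D)] K.obj X₀) :
    ∃ (Y₀ : 𝒴) (η : F.obj Y₀ ⟶ X₀), Nonempty ((triFunctor T F K).obj ⟨Y₀, X₀, η⟩ ≅ Z) := by
  obtain ⟨Y₀, ⟨ψ⟩⟩ := hT.exists_linearEquiv he.unital_right hY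
  -- The decomposition is transported so that its summands are literally $K(X_0)$ and
  -- $\bigoplus_j\mathrm{Hom}(T_j,Y_0)$.
  have he' : IsDecomposition T (F ⋙ K)
      (e.trans (AddEquiv.prodCongr φ.toAddEquiv ψ.symm.toAddEquiv)) :=
    { unital_left := hK X₀
      unital_right := HomSum.isUnitalModule Y₀
      diagonal := fun x y z => by
        change (φ (e (of _ • z)).1, ψ.symm (e (of _ • z)).2) =
          (of x • φ (e z).1, of y • ψ.symm (e z).2)
        rw [he.diagonal, map_smul, map_smul] }
  obtain ⟨η, ⟨ε⟩⟩ := he'.exists_triMod_equiv hT (hfin Y₀) fun j => hK _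
  obtain ⟨η, rfl⟩ : ∃ η' : F.obj Y₀ ⟶ X₀, (K.map η').hom = η :=
    ⟨K.preimage (ModuleCat.ofHom η), by rw [K.map_preimage]; rfl⟩
  exact ⟨Y₀, η, ⟨ε.toModuleIso⟩⟩

end EssSurj

open Plus TriRing

section CommaIncl

variable {𝒳 : Type*} [Category* 𝒳] {𝒴 : Type*} [Category* 𝒴] {𝒳t : Type*} [Category* 𝒳t]
  (F : 𝒴 ⥤ 𝒳t) (inc : 𝒳 ⥤ 𝒳t)

instance [inc.Faithful] : (commaIncl F inc).Faithful where
  map_injective {_ _} _ _ h := CommaMorphism.ext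
    (congrArg (CommaMorphism.left : _ → _) h :)
    (inc.map_injective (congrArg CommaMorphism.right h :))

instance [inc.Full] : (commaIncl F inc).Full where
  map_surjective {Z Z'} f := by
    obtain ⟨g, hg⟩ := inc.map_surjective (X := Z.right) (Y := Z'.right) f.right
    refine ⟨⟨f.left, g, ?_⟩, CommaMorphism.ext rfl hg⟩
    rw [hg]
    exact f.w

end CommaIncl

/-- Serre subcategories are closed under finite products. (This is not an instance, in order not
to interfere with the preadditive structure of full subcategories.) -/
lemma isClosedUnderFiniteProducts_of_isSerreClass {C : Type u} [Category.{v} C] [Abelian C]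
    (P : ObjectProperty C) [P.IsSerreClass] :
    P.IsClosedUnderFiniteProducts :=
  have : P.IsClosedUnderBinaryProducts :=
    { limitsOfShape_le := by
        rintro X ⟨p⟩
        refine P.prop_of_iso ?_ (P.prop_biprod (p.prop_diag_obj (.mk .left))
          (p.prop_diag_obj (.mk .right)))
        exact IsLimit.conePointUniqueUpToIso (BinaryBiproduct.isLimit _ _)
          ((IsLimit.postcomposeHomEquiv (diagramIsoPair p.diag) _).2 p.isLimit) }
  .mk'

/-- Every object of a semi-simple Serre subcategory of a category of artinian objects is a direct
summand of a finite direct sum of simple objects. -/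
lemma IsSimpleRepresentatives.isFiniteSummand_fullSubcategory {C : Type u} [Category.{v} C]
    [Abelian C] {P : ObjectProperty C} [P.IsSerreClass]
    (hP : IsSemisimpleCategory P.FullSubcategory) (hC : ∀ Z : C, IsArtinianObject Z)
    {I : Type w} {S : I → P.FullSubcategory} (hS : IsSimpleRepresentatives S)
    (X : P.FullSubcategory) : IsFiniteSummand S X := by
  have := isClosedUnderFiniteProducts_of_isSerreClass P
  have := P.preservesMonomorphisms_ι_of_isNormalEpiCategory
  have := hC X.obj
  have := isArtinianObject_fullSubcategory P X
  exact hS.isFiniteSummand hP X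

section Equivalences

variable {𝒴 : Type u} [Category.{v} 𝒴] [Abelian 𝒴] {J : Type w} {T : J → 𝒴}
  {𝒳t : Type u'} [Category.{v'} 𝒳t] {F : 𝒴 ⥤ 𝒳t}

/-- Triples are locally finite modules over the triangular matrix ring. -/
lemma isEquivalence_lift_triFunctor {I : Type*} {D : I → Type*} [∀ i, Ring (D i)]
    {K : 𝒳t ⥤ ModuleCat.{max w v} (Plus (SumRing D))} [(F ⋙ K).Additive] [K.Full] [K.Faithful]
    (hT : IsSimpleRepresentatives T) (hfin : ∀ Y : 𝒴, IsFiniteSummand T Y)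
    (hK : ∀ X, semisimpleModules (SumRing D) (K.obj X))
    (hK' : ∀ N, semisimpleModules (SumRing D) N → ∃ X, Nonempty (K.obj X ≅ N)) :
    ((locallyFiniteModules T (SumRing D) (F ⋙ K)).lift (triFunctor T F K)
      (locallyFiniteModules_triFunctor hT hfin hK)).IsEquivalence := by
  have := triFunctor_faithful (F := F) (K := K) hfin
  have := triFunctor_full (F := F) (K := K) hT hfin fun X => (hK X).1
  refine { essSurj := ⟨?_⟩ }
  rintro ⟨Z, X, Y, e, hX, hY, he⟩
  obtain ⟨X₀, ⟨φ⟩⟩ := hK' X hX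
  obtain ⟨Y₀, η, ⟨ε⟩⟩ := exists_triFunctor_obj_iso hT hfin (fun X => (hK X).1)
    (⟨hX.1, hY.1, he⟩ : IsDecomposition T (F ⋙ K) e) hY.2 φ.symm.toLinearEquiv
  exact ⟨⟨Y₀, X₀, η⟩, ⟨ObjectProperty.isoMk _ ε⟩⟩

variable {𝒳 : Type*} [Category.{v} 𝒳] [Abelian 𝒳] {I : Type w} {S : I → 𝒳} {inc : 𝒳 ⥤ 𝒳t}
  {K : 𝒳t ⥤ ModuleCat.{max w v} (Plus (EndRing S))} [(F ⋙ K).Additive]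

/-- For $X$ in $\mathcal X$ the isomorphism `φ` identifies the left summand with
$\bigoplus_i\mathrm{Hom}(S_i,X)$, which has finite length; then both summands do. -/
lemma finiteLengthModules_triFunctor (hS : IsSimpleRepresentatives S)
    (hT : IsSimpleRepresentatives T) (hfinS : ∀ X : 𝒳, IsFiniteSummand S X)
    (hfin : ∀ Y : 𝒴, IsFiniteSummand T Y) (hK : ∀ X, IsUnitalModule (EndRing S) (K.obj X))
    (φ : inc ⋙ K ≅ homFunctor S) (Z : Comma F inc) :
    finiteLengthModules (TriRing T (EndRing S) (F ⋙ K))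
      ((commaIncl F inc ⋙ triFunctor T F K).obj Z) := by
  have he := triFunctor_obj_isDecomposition (T := T) hK ((commaIncl F inc).obj Z)
  have hX : IsFiniteLength (Plus (EndRing S)) (K.obj (inc.obj Z.right)) :=
    (φ.app Z.right).symm.toLinearEquiv.isFiniteLength (hS.isFiniteLength_homSum (hfinS Z.right))
  have hY := hT.isFiniteLength_homSum (hfin Z.left)
  have h₁ := he.isFiniteLength hX hY
  have h₂ := he.isUnitalModule fun j => hK _
  exact ⟨h₂, h₁⟩

/-- Triples with finite components are modules of finite length over the triangular matrix
ring. -/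
lemma isEquivalence_lift_commaIncl_triFunctor [inc.Full] [inc.Faithful] [K.Full] [K.Faithful]
    (hS : IsSimpleRepresentatives S)
    (hT : IsSimpleRepresentatives T) (hfinS : ∀ X : 𝒳, IsFiniteSummand S X)
    (hfin : ∀ Y : 𝒴, IsFiniteSummand T Y) (hK : ∀ X, IsUnitalModule (EndRing S) (K.obj X))
    (φ : inc ⋙ K ≅ homFunctor S) :
    ((finiteLengthModules (TriRing T (EndRing S) (F ⋙ K))).lift
      (commaIncl F inc ⋙ triFunctor T F K)
      (finiteLengthModules_triFunctor hS hT hfinS hfin hK φ)).IsEquivalence := by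
  have := triFunctor_faithful (F := F) (K := K) hfin
  have := triFunctor_full (F := F) (K := K) hT hfin hK
  refine { essSurj := ⟨?_⟩ }
  rintro ⟨Z, hZ, hZ'⟩
  have hG (j) : IsUnitalModule (EndRing S) ((F ⋙ K).obj (T j)) := hK _
  -- In contrast with locally finite modules, no splitting is given here; it is produced from
  -- $RZ=Z$.
  obtain ⟨e, he⟩ := exists_isDecomposition hG hZ
  have hl := he.isFiniteLength_left hG hZ'
  have hr := he.isFiniteLength_right hG hZ'
  obtain ⟨X, ⟨ψ⟩⟩ := hS.exists_linearEquiv he.unital_left hl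
  -- The left summand has finite length, so it is realised by an object of $\mathcal X$ itself and
  -- the triple lies in $\mathcal F$.
  obtain ⟨Y, η, ⟨ε⟩⟩ := exists_triFunctor_obj_iso (X₀ := inc.obj X) hT hfin hK he hr
    (ψ.symm.trans (φ.app X).symm.toLinearEquiv)
  exact ⟨⟨Y, X, η⟩, ⟨ObjectProperty.isoMk _ ε⟩⟩

end Equivalences

end TorsionExt

end

theorem theorem2
    -- an abelian category with a torsion pair
    {C : Type u} [Category.{v} C] [Abelian C] [HasExt.{w'} C]
    (𝒳 𝒴 : ObjectProperty C) (_htors : TorsionExt.IsTorsionPair 𝒳 𝒴)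
    -- (a) Serre subcategories
    [𝒳.IsSerreClass] [𝒴.IsSerreClass]
    -- (b) semi-simplicity
    (_hss𝒳 : TorsionExt.IsSemisimpleCategory 𝒳.FullSubcategory)
    (_hss𝒴 : TorsionExt.IsSemisimpleCategory 𝒴.FullSubcategory)
    -- (c) there are no non-zero morphisms from `𝒴` to `𝒳`
    (_hom : ∀ ⦃X Y : C⦄, 𝒳 X → 𝒴 Y → ∀ f : Y ⟶ X, f = 0)
    -- (d) a semi-simple abelian category containing `𝒳` as a Serre subcategory, an exact
    -- functor `F` and a bifunctorial isomorphism `Ext¹(Y, X) ≅ Hom(F(Y), X)`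
    {𝒳t : Type u'} [Category.{v'} 𝒳t] [Abelian 𝒳t]
    (_hss𝒳t : TorsionExt.IsSemisimpleCategory 𝒳t)
    (inc : 𝒳.FullSubcategory ⥤ 𝒳t) [inc.Full] [inc.Faithful] [inc.essImage.IsSerreClass]
    (F : 𝒴.FullSubcategory ⥤ 𝒳t) [F.Additive] [PreservesFiniteLimits F]
    [PreservesFiniteColimits F]
    (Φ : ∀ (Y : 𝒴.FullSubcategory) (X : 𝒳.FullSubcategory),
      Ext Y.obj X.obj 1 ≃+ (F.obj Y ⟶ inc.obj X))
    (_hΦ_right : ∀ (Y : 𝒴.FullSubcategory) ⦃X X' : 𝒳.FullSubcategory⦄ (f : X ⟶ X')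
      (e : Ext Y.obj X.obj 1),
      Φ Y X' (e.comp (Ext.mk₀ f.hom) (add_zero 1)) = Φ Y X e ≫ inc.map f)
    (_hΦ_left : ∀ ⦃Y Y' : 𝒴.FullSubcategory⦄ (g : Y ⟶ Y') (X : 𝒳.FullSubcategory)
      (e : Ext Y'.obj X.obj 1),
      Φ Y X ((Ext.mk₀ g.hom).comp e (zero_add 1)) = F.map g ≫ Φ Y' X e)
    -- every object of `C` has finite length
    (_hfl : ∀ Z : C, IsNoetherianObject Z ∧ IsArtinianObject Z)
    -- representatives of the isomorphism classes of simple objects of `𝒳` and of `𝒴`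
    {I J : Type w} (S : I → 𝒳.FullSubcategory) (T : J → 𝒴.FullSubcategory)
    (_hS : TorsionExt.IsSimpleRepresentatives S) (_hT : TorsionExt.IsSimpleRepresentatives T)
    -- (e) the functor `X ↦ ⨁ Hom(S i, X)` from `𝒳` to modules over `R_𝒳 = ⨁ D i` extends to an
    -- equivalence of `𝒳t` with the category of semi-simple modules over `R_𝒳`
    (E : 𝒳t ⥤ (TorsionExt.semisimpleModules.{max w v}
      (TorsionExt.EndRing S)).FullSubcategory) [E.IsEquivalence] [E.Additive]
    (_hE : Nonempty (inc ⋙ E ⋙ (TorsionExt.semisimpleModules.{max w v}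
      (TorsionExt.EndRing S)).ι ≅ TorsionExt.homFunctor S)) :
    letI R_𝒳 := TorsionExt.EndRing S
    letI R := TorsionExt.TriRing T R_𝒳 (F ⋙ E ⋙ (TorsionExt.semisimpleModules R_𝒳).ι)
    letI R_mod := TorsionExt.finiteLengthModules.{max w v} R
    letI R_tmod := TorsionExt.locallyFiniteModules.{w, max w v} T R_𝒳
      (F ⋙ E ⋙ (TorsionExt.semisimpleModules.{max w v} R_𝒳).ι)
    TorsionExt.IsHereditaryAbelian (Comma F inc) ∧
    TorsionExt.IsHereditaryAbelian (Comma F (𝟭 𝒳t)) ∧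
    EnoughProjectives (Comma F (𝟭 𝒳t)) ∧
    ∃ (M : Comma F inc ≌ R_mod.FullSubcategory)
      (Mt : Comma F (𝟭 𝒳t) ≌ R_tmod.FullSubcategory),
      Nonempty (M.functor ⋙ R_mod.ι ≅
        TorsionExt.commaIncl F inc ⋙ Mt.functor ⋙ R_tmod.ι) := by
  let R_𝒳 := TorsionExt.EndRing S
  have := TorsionExt.isClosedUnderFiniteProducts_of_isSerreClass 𝒳
  have := TorsionExt.isClosedUnderFiniteProducts_of_isSerreClass 𝒴
  let K := E ⋙ (TorsionExt.semisimpleModules.{max w v} R_𝒳).ι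
  have hfinS := _hS.isFiniteSummand_fullSubcategory _hss𝒳 fun Z => (_hfl Z).2
  have hfinT := _hT.isFiniteSummand_fullSubcategory _hss𝒴 fun Z => (_hfl Z).2
  have hK (X) : TorsionExt.semisimpleModules R_𝒳 (K.obj X) := (E.obj X).property
  obtain ⟨φ⟩ := _hE
  -- Additivity of `inc` is deduced from that of `homFunctor` and faithfulness of `K`. Exactness
  -- then follows from semi-simplicity of $\mathcal X$, and it makes the category of triples over
  -- `inc` abelian.
  have : (inc ⋙ K).Additive := Functor.additive_of_iso φ.symm
  have : inc.Additive := Functor.additive_of_comp_faithful inc K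
  have := (_hss𝒳.preservesFiniteLimits_and_colimits inc).1
  have h₁ := TorsionExt.isEquivalence_lift_commaIncl_triFunctor (F := F) (K := K) _hS _hT
    hfinS hfinT (fun X => (hK X).1) φ
  have h₂ := TorsionExt.isEquivalence_lift_triFunctor (F := F) (K := K) _hT hfinT hK
    fun N hN => ⟨_, ⟨(TorsionExt.semisimpleModules R_𝒳).ι.mapIso (E.objObjPreimageIso ⟨N, hN⟩)⟩⟩
  exact ⟨TorsionExt.isHereditaryAbelian_comma F inc _hss𝒴 _hss𝒳,
    TorsionExt.isHereditaryAbelian_comma F (𝟭 𝒳t) _hss𝒴 _hss𝒳t,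
    TorsionExt.enoughProjectives_comma F _hss𝒴 _hss𝒳t,
    -- Both equivalences are lifts of one functor, `triFunctor`, so their compatibility holds by
    -- definition.
    @Functor.asEquivalence _ _ _ _ _ h₁, @Functor.asEquivalence _ _ _ _ _ h₂, ⟨Iso.refl _⟩⟩
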